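/- Let $(T,h)$ and $(M,\varphi)$ be smooth semi-Riemannian manifolds of dimensions $p$ and $n$, let $J^1(T,M)$ be the 1-jet space with induced local coordinates $(t^\alpha,x^i,x^i_\alpha)$, and let $\sigma:J^1(T,M)\to\mathbb R$ be smooth. Write $H^\gamma_{\alpha\beta}$, $\gamma^k_{ij}$ for the Christoffel symbols of $h$, $\varphi$; the curvature tensor of $\varphi$ is $r^l_{ijk}=\partial_k\gamma^l_{ij}-\partial_j\gamma^l_{ik}+\gamma^m_{ij}\gamma^l_{mk}-\gamma^m_{ik}\gamma^l_{mj}$, with Ricci tensor $r_{ij}=r^l_{ijl}$ and scalar curvature $\varphi^{ij}r_{ij}$, and likewise for $h$. Consider the nonlinear connection $M^{(i)}_{(\alpha)\beta}=-H^\mu_{\alpha\beta}x^i_\mu$, $N^{(i)}_{(\alpha)j}=\gamma^i_{jm}x^m_\alpha$, with adapted frame $(X_A)$ consisting of $$\frac{\delta}{\delta t^\alpha}=\frac{\partial}{\partial t^\alpha}-M^{(j)}_{(\beta)\alpha}\frac{\partial}{\partial x^j_\beta},\qquad \frac{\delta}{\delta x^i}=\frac{\partial}{\partial x^i}-N^{(j)}_{(\beta)i}\frac{\partial}{\partial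 x^j_\beta},\qquad \frac{\partial}{\partial x^i_\alpha},$$ dual coframe $(dt^\alpha,dx^i,\delta x^i_\alpha)$, and the metric $$G=h_{\alpha\beta}\,dt^\alpha\otimes dt^\beta+g_{ij}\,dx^i\otimes dx^j+h^{\alpha\beta}g_{ij}\,\delta x^i_\alpha\otimes\delta x^j_\beta,\qquad g_{ij}=e^{2\sigma}\varphi_{ij}.$$ Let $C\Gamma=(H^\gamma_{\alpha\beta},G^k_{j\gamma},L^k_{ij},C^{k(\gamma)}_{i(j)})$ be the Cartan canonical connection, that is, $$G^k_{j\gamma}=\tfrac12g^{km}\frac{\delta g_{mj}}{\delta t^\gamma},\quad L^k_{ij}=\tfrac12g^{km}\Big(\frac{\delta g_{im}}{\delta x^j}+\frac{\delta g_{jm}}{\delta x^i}-\frac{\delta g_{ij}}{\delta x^m}\Big),\quad C^{k(\gamma)}_{i(j)}=\tfrac12g^{km}\Big(\frac{\partial g_{im}}{\partial x^j_\gamma}+\frac{\partial g_{jm}}{\partial x^i_\gamma}-\frac{\partial g_{ij}}{\partial x^m_\gamma}\Big),$$ and $\nabla$ is the linear connection on $J^1(T,M)$ with $$\nabla_{\delta/\delta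 t^\beta}\tfrac{\delta}{\delta t^\alpha}=H^\gamma_{\alpha\beta}\tfrac{\delta}{\delta t^\gamma},\qquad \nabla_{\delta/\delta x^j}\tfrac{\delta}{\delta t^\alpha}=0,\qquad \nabla_{\partial/\partial x^j_\beta}\tfrac{\delta}{\delta t^\alpha}=0,$$ $$\nabla_{\delta/\delta t^\beta}\tfrac{\delta}{\delta x^i}=G^k_{i\beta}\tfrac{\delta}{\delta x^k},\qquad \nabla_{\delta/\delta x^j}\tfrac{\delta}{\delta x^i}=L^k_{ij}\tfrac{\delta}{\delta x^k},\qquad \nabla_{\partial/\partial x^j_\beta}\tfrac{\delta}{\delta x^i}=C^{k(\beta)}_{i(j)}\tfrac{\delta}{\delta x^k},$$ $$\nabla_{\delta/\delta t^\beta}\tfrac{\partial}{\partial x^i_\alpha}=G^k_{i\beta}\tfrac{\partial}{\partial x^k_\alpha}-H^\alpha_{\gamma\beta}\tfrac{\partial}{\partial x^i_\gamma},\qquad \nabla_{\delta/\delta x^j}\tfrac{\partial}{\partial x^i_\alpha}=L^k_{ij}\tfrac{\partial}{\partial x^k_\alpha},\qquad \nabla_{\partial/\partial x^j_\beta}\tfrac{\partial}{\partial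 x^i_\alpha}=C^{k(\beta)}_{i(j)}\tfrac{\partial}{\partial x^k_\alpha}.$$ With $\mathbf R(V,W)Z=\nabla_V\nabla_WZ-\nabla_W\nabla_VZ-\nabla_{[V,W]}Z$ and $\mathbf R(X_C,X_B)X_A=R^D_{ABC}X_D$, put $R_{AB}=R^D_{ABD}$ and $Sc(C\Gamma)=G^{AB}R_{AB}$, where $(G^{AB})$ is the inverse of $(G_{AB})$. Let $H=h^{\alpha\beta}R_{\alpha\beta}$, $R=e^{-2\sigma}\varphi^{ij}R_{ij}$ and $S=h_{\alpha\beta}e^{-2\sigma}\varphi^{ij}S^{(\alpha)(\beta)}_{(i)(j)}$ be the temporal, spatial and vertical traces, where $S^{(\alpha)(\beta)}_{(i)(j)}$ is $R_{AB}$ for $A,B$ the indices of $\partial/\partial x^i_\alpha$, $\partial/\partial x^j_\beta$. Then, in every induced coordinate system, $$Sc(C\Gamma)=H+R+S,$$ where $H$ is the scalar curvature of $h$, $$R=e^{-2\sigma}\left[r+2(1-n)\langle\sigma\rangle+2r_{ms}\sigma^{s\mu}x^m_\mu\right],\qquad S=2(1-n)e^{-2\sigma}\langle\langle\sigma\rangle\rangle,$$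 and $r$ is the scalar curvature of $\varphi$. Here $\sigma_k=\delta\sigma/\delta x^k$, $\sigma^{(\gamma)}_{(k)}=\partial\sigma/\partial x^k_\gamma$, $\sigma^{s\mu}=\varphi^{sm}\sigma^{(\mu)}_{(m)}$, $$\sigma_{jk}=\frac{\delta\sigma_j}{\delta x^k}-\gamma^m_{jk}\sigma_m-\sigma_j\sigma_k+\tfrac12\varphi_{jk}\varphi^{rm}\sigma_r\sigma_m,$$ $$\sigma^{(\beta)(\gamma)}_{(j)(k)}=\frac{\partial^2\sigma}{\partial x^j_\beta\,\partial x^k_\gamma}-\sigma^{(\beta)}_{(j)}\sigma^{(\gamma)}_{(k)}+\tfrac12\varphi_{jk}\varphi^{rm}\sigma^{(\beta)}_{(r)}\sigma^{(\gamma)}_{(m)},$$ $\langle\sigma\rangle=\varphi^{rs}\sigma_{rs}$ and $\langle\langle\sigma\rangle\rangle=h_{\alpha\beta}\varphi^{rs}\sigma^{(\alpha)(\beta)}_{(r)(s)}$. -/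

import Mathlib

open scoped Manifold ContDiff

noncomputable section

namespace GRGML

/-! ## Semi-Riemannian manifolds and the 1-jet space -/

/-- The model space `ℝ^d`. -/
abbrev E (d : ℕ) : Type := EuclideanSpace ℝ (Fin d)

/-- The standard basis vector `∂/∂u^a` of `ℝ^d`. -/
def basisVec {d : ℕ} (a : Fin d) : E d := EuclideanSpace.single a 1

section Charts

variable {d : ℕ} {X : Type*} [TopologicalSpace X] [ChartedSpace (E d) X]

/-- The coordinate tangent vector `∂/∂u^a` of the chart `e` at the point with coordinates `u`. -/
def coordVec (e : OpenPartialHomeomorph X (E d)) (u : E d) (a : Fin d) :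
    TangentSpace (𝓡 d) (e.symm u) :=
  mfderiv (𝓡 d) (𝓡 d) e.symm u (basisVec a)

end Charts

/-- A smooth semi-Riemannian metric on a `d`-dimensional manifold `X`: a smooth field of symmetric
nondegenerate bilinear forms of constant index on the tangent spaces. -/
structure SemiRiemannianMetric (d : ℕ) (X : Type*) [TopologicalSpace X] [ChartedSpace (E d) X]
    [IsManifold (𝓡 d) ∞ X] where
  /-- the bilinear form on the tangent space at `x` -/
  val (x : X) : LinearMap.BilinForm ℝ (TangentSpace (𝓡 d) x)
  symm (x : X) (v w : TangentSpace (𝓡 d) x) : val x v w = val x w v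
  nondegenerate (x : X) (v : TangentSpace (𝓡 d) x) : (∀ w, val x v w = 0) → v = 0
  /-- the index (largest dimension of a negative definite subspace) is the same everywhere -/
  constIndex : ∃ k : ℕ, ∀ x : X,
    IsGreatest {m : ℕ | ∃ W : Submodule ℝ (TangentSpace (𝓡 d) x),
      Module.finrank ℝ W = m ∧ ∀ v ∈ W, v ≠ 0 → val x v v < 0} k
  /-- the components in every chart are smooth functions of the coordinates -/
  smooth (e : OpenPartialHomeomorph X (E d)) (he : e ∈ IsManifold.maximalAtlas (𝓡 d) ∞ X)
    (a b : Fin d) :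
    ContDiffOn ℝ ∞ (fun u => val (e.symm u) (coordVec e u a) (coordVec e u b)) e.target

/-- The matrix of components of a metric in the chart `e`, as a function of the coordinates. -/
def SemiRiemannianMetric.components {d : ℕ} {X : Type*} [TopologicalSpace X]
    [ChartedSpace (E d) X] [IsManifold (𝓡 d) ∞ X] (g : SemiRiemannianMetric d X)
    (e : OpenPartialHomeomorph X (E d)) (u : E d) : Matrix (Fin d) (Fin d) ℝ :=
  Matrix.of fun a b => g.val (e.symm u) (coordVec e u a) (coordVec e u b)

/-- The first-order jet space `J¹(T,M)`: a point `t` of `T`, a point `x` of `M`, and a linear map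
`T_t T → T_x M`. -/
structure OneJet (p n : ℕ) (T M : Type*) [TopologicalSpace T] [ChartedSpace (E p) T]
    [TopologicalSpace M] [ChartedSpace (E n) M] where
  time : T
  pos : M
  dir : TangentSpace (𝓡 p) time →L[ℝ] TangentSpace (𝓡 n) pos

/-- The coordinates `(t^α, x^i, x^i_α)` on the jet space. -/
abbrev Coord (p n : ℕ) : Type := E p × E n × (Fin n → Fin p → ℝ)

section JetCharts

variable {p n : ℕ} {T M : Type*} [TopologicalSpace T] [ChartedSpace (E p) T]
  [TopologicalSpace M] [ChartedSpace (E n) M]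

/-- The induced coordinates of a jet: `x^i_α` is the `i`-th component of the image of
`∂/∂t^α`. -/
def OneJet.coords (e : OpenPartialHomeomorph T (E p)) (f : OpenPartialHomeomorph M (E n))
    (q : OneJet p n T M) : Coord p n :=
  (e q.time, f q.pos, fun i α =>
    (show E n from mfderiv (𝓡 n) (𝓡 n) f q.pos (q.dir
      (mfderiv (𝓡 p) (𝓡 p) e.symm (e q.time) (basisVec α) : E p))) i)

/-- The linear map `ℝ^p → ℝ^n` with matrix `(y^i_α)`. -/
def dirMap (y : Fin n → Fin p → ℝ) : E p →L[ℝ] E n :=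
  LinearMap.toContinuousLinearMap (Matrix.toEuclideanLin (Matrix.of y))

/-- The jet with given coordinates (inverse of `OneJet.coords` on the chart domain). -/
def OneJet.ofCoords (e : OpenPartialHomeomorph T (E p)) (f : OpenPartialHomeomorph M (E n))
    (z : Coord p n) : OneJet p n T M where
  time := e.symm z.1
  pos := f.symm z.2.1
  dir := (show E n →L[ℝ] TangentSpace (𝓡 n) (f.symm z.2.1) from
      mfderiv (𝓡 n) (𝓡 n) f.symm z.2.1) ∘L dirMap z.2.2 ∘L
    (show TangentSpace (𝓡 p) (e.symm z.1) →L[ℝ] E p from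
      mfderiv (𝓡 p) (𝓡 p) e (e.symm z.1))

/-- Smoothness of a real function on `J¹(T,M)`: all its expressions in the induced coordinate
systems are smooth. -/
def JetSmooth (σ : OneJet p n T M → ℝ) : Prop :=
  ∀ e ∈ IsManifold.maximalAtlas (𝓡 p) ∞ T, ∀ f ∈ IsManifold.maximalAtlas (𝓡 n) ∞ M,
    ContDiffOn ℝ ∞ (fun z => σ (OneJet.ofCoords e f z))
      {z : Coord p n | z.1 ∈ e.target ∧ z.2.1 ∈ f.target}

end JetCharts

/-! ## Classical Riemannian quantities in coordinates -/

section Classical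

variable {d : ℕ}

/-- `∂F/∂u^a`. -/
def pd (a : Fin d) (F : E d → ℝ) (u : E d) : ℝ := fderiv ℝ F u (basisVec a)

/-- The Christoffel symbol `Γ^k_{ij}` of the metric `g`. -/
def christoffel (g : E d → Matrix (Fin d) (Fin d) ℝ) (k i j : Fin d) (u : E d) : ℝ :=
  1 / 2 * ∑ m, (g u)⁻¹ k m *
    (pd i (fun w => g w j m) u + pd j (fun w => g w i m) u - pd m (fun w => g w i j) u)

/-- The curvature tensor `r^l_{ijk}`, the `∂_l`-component of `R(∂_k, ∂_j) ∂_i`. -/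
def riemann (g : E d → Matrix (Fin d) (Fin d) ℝ) (l i j k : Fin d) (u : E d) : ℝ :=
  pd k (christoffel g l i j) u - pd j (christoffel g l i k) u +
    ∑ m, (christoffel g m i j u * christoffel g l m k u -
      christoffel g m i k u * christoffel g l m j u)

/-- The Ricci tensor `r_{ij} = r^l_{ijl}`. -/
def ricci (g : E d → Matrix (Fin d) (Fin d) ℝ) (i j : Fin d) (u : E d) : ℝ :=
  ∑ l, riemann g l i j l u

/-- The scalar curvature `g^{ij} r_{ij}`. -/
def scalarCurv (g : E d → Matrix (Fin d) (Fin d) ℝ) (u : E d) : ℝ :=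
  ∑ i, ∑ j, (g u)⁻¹ i j * ricci g i j u

end Classical

/-! ## The geometry of the space in one induced coordinate system -/

/-- The coordinate expressions of `h_{αβ}(t)`, `φ_{ij}(x)` and `σ(t,x,x_α)`. -/
structure LocalData (p n : ℕ) where
  h : E p → Matrix (Fin p) (Fin p) ℝ
  φ : E n → Matrix (Fin n) (Fin n) ℝ
  σ : Coord p n → ℝ

/-- The coordinate expressions in the coordinates induced by charts `e` of `T` and `f` of `M`. -/
def localData {p n : ℕ} {T M : Type*} [TopologicalSpace T] [ChartedSpace (E p) T]
    [IsManifold (𝓡 p) ∞ T] [TopologicalSpace M] [ChartedSpace (E n) M] [IsManifold (𝓡 n) ∞ M]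
    (h : SemiRiemannianMetric p T) (φ : SemiRiemannianMetric n M) (σ : OneJet p n T M → ℝ)
    (e : OpenPartialHomeomorph T (E p)) (f : OpenPartialHomeomorph M (E n)) : LocalData p n where
  h := h.components e
  φ := φ.components f
  σ := fun z => σ (OneJet.ofCoords e f z)

/-- Indices of the adapted frame: temporal `α`, spatial `i`, vertical `(i, α)`. -/
abbrev Idx (p n : ℕ) : Type := Fin p ⊕ Fin n ⊕ (Fin n × Fin p)

namespace LocalData

variable {p n : ℕ} (D : LocalData p n)

/-- `∂/∂t^α`. -/
def ddt (α : Fin p) : Coord p n := (basisVec α, 0, 0)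

/-- `∂/∂x^i`. -/
def ddx (i : Fin n) : Coord p n := (0, basisVec i, 0)

/-- `∂/∂x^i_α`. -/
def ddy (i : Fin n) (α : Fin p) : Coord p n := (0, 0, Pi.single i (Pi.single α 1))

/-- The temporal components `M^{(i)}_{(α)β} = -H^μ_{αβ} x^i_μ` of the nonlinear connection. -/
def nlM (i : Fin n) (α β : Fin p) (z : Coord p n) : ℝ :=
  -∑ μ, christoffel D.h μ α β z.1 * z.2.2 i μ

/-- The spatial components `N^{(i)}_{(α)j} = γ^i_{jm} x^m_α` of the nonlinear connection. -/
def nlN (i : Fin n) (α : Fin p) (j : Fin n) (z : Coord p n) : ℝ :=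
  ∑ m, christoffel D.φ i j m z.2.1 * z.2.2 m α

/-- The adapted frame `(δ/δt^α, δ/δx^i, ∂/∂x^i_α)`. -/
def frame : Idx p n → Coord p n → Coord p n
  | .inl α, z => ddt α - ∑ j, ∑ β, D.nlM j β α z • ddy j β
  | .inr (.inl i), z => ddx i - ∑ j, ∑ β, D.nlN j β i z • ddy j β
  | .inr (.inr (i, α)), _ => ddy i α

/-- The dual coframe `(dt^α, dx^i, δx^i_α)`, evaluated at the point `z` on the vector `v`. -/
def coframe : Idx p n → Coord p n → Coord p n → ℝ
  | .inl α, _, v => v.1 α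
  | .inr (.inl i), _, v => v.2.1 i
  | .inr (.inr (i, α)), z, v =>
      v.2.2 i α + ∑ β, D.nlM i α β z * v.1 β + ∑ j, D.nlN i α j z * v.2.1 j

/-- The derivative of the function `F` along the frame field `X_A`. -/
def der (A : Idx p n) (F : Coord p n → ℝ) (z : Coord p n) : ℝ := fderiv ℝ F z (D.frame A z)

/-- The spatial metrical d-tensor `g_{ij} = e^{2σ} φ_{ij}`. -/
def g (z : Coord p n) : Matrix (Fin n) (Fin n) ℝ := Real.exp (2 * D.σ z) • D.φ z.2.1

/-- The components in the adapted frame of the gravitational potential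
`G = h_{αβ} dt^α ⊗ dt^β + g_{ij} dx^i ⊗ dx^j + h^{αβ} g_{ij} δx^i_α ⊗ δx^j_β`. -/
def G (z : Coord p n) : Matrix (Idx p n) (Idx p n) ℝ := Matrix.of fun A B =>
  match A, B with
  | .inl α, .inl β => D.h z.1 α β
  | .inr (.inl i), .inr (.inl j) => D.g z i j
  | .inr (.inr (i, α)), .inr (.inr (j, β)) => (D.h z.1)⁻¹ α β * D.g z i j
  | _, _ => 0

/-! ### The Cartan canonical connection -/

/-- `G^k_{jγ} = ½ g^{km} δg_{mj}/δt^γ`. -/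
def cartanG (k j : Fin n) (γ : Fin p) (z : Coord p n) : ℝ :=
  1 / 2 * ∑ m, (D.g z)⁻¹ k m * D.der (.inl γ) (fun w => D.g w m j) z

/-- `L^k_{ij} = ½ g^{km} (δg_{im}/δx^j + δg_{jm}/δx^i - δg_{ij}/δx^m)`. -/
def cartanL (k i j : Fin n) (z : Coord p n) : ℝ :=
  1 / 2 * ∑ m, (D.g z)⁻¹ k m *
    (D.der (.inr (.inl j)) (fun w => D.g w i m) z + D.der (.inr (.inl i)) (fun w => D.g w j m) z
      - D.der (.inr (.inl m)) (fun w => D.g w i j) z)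

/-- `C^{k(γ)}_{i(j)} = ½ g^{km} (∂g_{im}/∂x^j_γ + ∂g_{jm}/∂x^i_γ - ∂g_{ij}/∂x^m_γ)`. -/
def cartanC (k i j : Fin n) (γ : Fin p) (z : Coord p n) : ℝ :=
  1 / 2 * ∑ m, (D.g z)⁻¹ k m *
    (D.der (.inr (.inr (j, γ))) (fun w => D.g w i m) z
      + D.der (.inr (.inr (i, γ))) (fun w => D.g w j m) z
      - D.der (.inr (.inr (m, γ))) (fun w => D.g w i j) z)

/-- The coefficients `Γ^C_{AB}`, `∇_{X_B} X_A = Γ^C_{AB} X_C`, of the `h`-normal linear connection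
`(H^γ_{αβ}, G^k_{jγ}, L^k_{ij}, C^{k(γ)}_{i(j)})`; arguments in the order `C, A, B`. -/
def conn : Idx p n → Idx p n → Idx p n → Coord p n → ℝ
  | .inl γ, .inl α, .inl β, z => christoffel D.h γ α β z.1
  | .inr (.inl k), .inr (.inl i), .inl β, z => D.cartanG k i β z
  | .inr (.inl k), .inr (.inl i), .inr (.inl j), z => D.cartanL k i j z
  | .inr (.inl k), .inr (.inl i), .inr (.inr (j, β)), z => D.cartanC k i j β z
  | .inr (.inr (k, γ)), .inr (.inr (i, α)), .inl β, z =>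
      (if α = γ then D.cartanG k i β z else 0) - (if k = i then christoffel D.h α γ β z.1 else 0)
  | .inr (.inr (k, γ)), .inr (.inr (i, α)), .inr (.inl j), z =>
      if α = γ then D.cartanL k i j z else 0
  | .inr (.inr (k, γ)), .inr (.inr (i, α)), .inr (.inr (j, β)), z =>
      if α = γ then D.cartanC k i j β z else 0
  | _, _, _, _ => 0

/-- The covariant derivative `∇_V Z` of vector fields for the Cartan canonical connection. -/
def nabla (V Z : Coord p n → Coord p n) (z : Coord p n) : Coord p n :=
  ∑ C, (fderiv ℝ (fun w => D.coframe C w (Z w)) z (V z) +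
    ∑ A, ∑ B, D.conn C A B z * D.coframe A z (Z z) * D.coframe B z (V z)) • D.frame C z

/-- The curvature `R(V,W)Z = ∇_V ∇_W Z - ∇_W ∇_V Z - ∇_{[V,W]} Z`. -/
def curv (V W Z : Coord p n → Coord p n) (z : Coord p n) : Coord p n :=
  D.nabla V (D.nabla W Z) z - D.nabla W (D.nabla V Z) z
    - D.nabla (VectorField.lieBracket ℝ V W) Z z

/-- The components `R^F_{ABC}` defined by `R(X_C, X_B) X_A = R^F_{ABC} X_F`. -/
def curvComp (F A B C : Idx p n) (z : Coord p n) : ℝ :=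
  D.coframe F z (D.curv (D.frame C) (D.frame B) (D.frame A) z)

/-- The Ricci d-tensor `R_{AB} = R^F_{ABF}` of the Cartan canonical connection. -/
def ric (A B : Idx p n) (z : Coord p n) : ℝ := ∑ F, D.curvComp F A B F z

/-- The scalar curvature `Sc(CΓ) = G^{AB} R_{AB}`. -/
def Sc (z : Coord p n) : ℝ := ∑ A, ∑ B, (D.G z)⁻¹ A B * D.ric A B z

/-- The temporal part `h^{αβ} R_{αβ}`. -/
def partH (z : Coord p n) : ℝ :=
  ∑ α, ∑ β, (D.h z.1)⁻¹ α β * D.ric (.inl α) (.inl β) z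

/-- The spatial part `e^{-2σ} φ^{ij} R_{ij}`. -/
def partR (z : Coord p n) : ℝ :=
  ∑ i, ∑ j, Real.exp (-2 * D.σ z) * (D.φ z.2.1)⁻¹ i j * D.ric (.inr (.inl i)) (.inr (.inl j)) z

/-- The vertical part `h_{αβ} e^{-2σ} φ^{ij} S^{(α)(β)}_{(i)(j)}`. -/
def partS (z : Coord p n) : ℝ :=
  ∑ i, ∑ j, ∑ α, ∑ β, D.h z.1 α β * Real.exp (-2 * D.σ z) * (D.φ z.2.1)⁻¹ i j *
    D.ric (.inr (.inr (i, α))) (.inr (.inr (j, β))) z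

/-! ### Quantities built from the conformal function -/

/-- `σ_k = δσ/δx^k`. -/
def sigH (k : Fin n) (z : Coord p n) : ℝ := D.der (.inr (.inl k)) D.σ z

/-- `σ^{(γ)}_{(k)} = ∂σ/∂x^k_γ`. -/
def sigV (k : Fin n) (γ : Fin p) (z : Coord p n) : ℝ := D.der (.inr (.inr (k, γ))) D.σ z

/-- `σ^{kγ} = φ^{km} σ^{(γ)}_{(m)}`. -/
def sigUp (k : Fin n) (γ : Fin p) (z : Coord p n) : ℝ :=
  ∑ m, (D.φ z.2.1)⁻¹ k m * D.sigV m γ z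

/-- `σ_{j‖k} = δσ_j/δx^k - σ_m γ^m_{jk}`, the Berwald covariant derivative. -/
def sigCov (j k : Fin n) (z : Coord p n) : ℝ :=
  D.der (.inr (.inl k)) (D.sigH j) z - ∑ m, D.sigH m z * christoffel D.φ m j k z.2.1

/-- `σ_{jk} = σ_{j‖k} - σ_j σ_k + ½ φ_{jk} φ^{rm} σ_r σ_m`. -/
def sigHH (j k : Fin n) (z : Coord p n) : ℝ :=
  D.sigCov j k z - D.sigH j z * D.sigH k z +
    1 / 2 * D.φ z.2.1 j k * ∑ r, ∑ m, (D.φ z.2.1)⁻¹ r m * D.sigH r z * D.sigH m z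

/-- `σ^{(β)(γ)}_{(j)(k)} = ∂²σ/∂x^j_β∂x^k_γ - σ^{(β)}_{(j)} σ^{(γ)}_{(k)}
+ ½ φ_{jk} φ^{rm} σ^{(β)}_{(r)} σ^{(γ)}_{(m)}`; arguments in the order `j, β, k, γ`. -/
def sigVV (j : Fin n) (β : Fin p) (k : Fin n) (γ : Fin p) (z : Coord p n) : ℝ :=
  D.der (.inr (.inr (k, γ))) (D.sigV j β) z - D.sigV j β z * D.sigV k γ z +
    1 / 2 * D.φ z.2.1 j k * ∑ r, ∑ m, (D.φ z.2.1)⁻¹ r m * D.sigV r β z * D.sigV m γ z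

/-- `<σ> = φ^{rs} σ_{rs}`. -/
def brH (z : Coord p n) : ℝ := ∑ r, ∑ s, (D.φ z.2.1)⁻¹ r s * D.sigHH r s z

/-- `<<σ>> = h_{αβ} <σ>^{αβ}` with `<σ>^{αβ} = φ^{rs} σ^{(α)(β)}_{(r)(s)}`. -/
def brV (z : Coord p n) : ℝ :=
  ∑ α, ∑ β, D.h z.1 α β * ∑ r, ∑ s, (D.φ z.2.1)⁻¹ r s * D.sigVV r α s β z

end LocalData

end GRGML

end

/-! In an induced chart everything becomes a computation with frame components, and the mechanism is
a conformal change of metric. Since g = e^{2σ}φ, the Koszul-type formulas give L = γ + `conf`(σ_k)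
and C = `conf`(σ^{(γ)}_{(k)}), where `conf` a is the tensor δ^k_i a_j + δ^k_j a_i − φ_ij φ^{km} a_m
(`cartanL_eq`, `cartanC_eq`).

The connection preserves the temporal, spatial and vertical distributions, so the curvature does too
(`curvComp_eq_zero`), and each diagonal block of the Ricci tensor is a trace over one distribution.
Together with the block form of G this splits the scalar curvature (`Sc_eq`). The temporal block is
the Levi-Civita connection of h.

In the spatial block, `conf` is built from φ, its inverse and δ, all parallel for γ, so
differentiating it only differentiates a (`der_pos_conf`). The mixed γ-`conf` terms then cancel,
leaving the curvature of φ and the classical conformal terms. One term is new: the fields δ/δx^i do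
not commute, their bracket is vertical with the curvature of φ as coefficient (`lieBracket_pos`),
and C pairs with it. The symmetries of φ and of the curvature turn its trace into twice a Ricci
contraction (`trace_conf_mul_antisymm`).

The vertical block follows the same algebra with γ absent and commuting fields. In both blocks
`trace_conf_ricci` yields 2(1 − n) times the bracket of σ, after contraction with h in the vertical
case. -/

namespace GRGML

/-! ### Metric components in a chart of the base manifolds -/

section Manifold

variable {d : ℕ} {X : Type*} [TopologicalSpace X] [ChartedSpace (E d) X]

theorem mdifferentiable_of_mem_maximalAtlas {e : OpenPartialHomeomorph X (E d)}
    (he : e ∈ IsManifold.maximalAtlas (𝓡 d) ∞ X) : e.MDifferentiable (𝓡 d) (𝓡 d) :=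
  ⟨(contMDiffOn_of_mem_maximalAtlas he).mdifferentiableOn (by simp),
    (contMDiffOn_symm_of_mem_maximalAtlas he).mdifferentiableOn (by simp)⟩

theorem sum_smul_basisVec (v : E d) : v = ∑ a, v a • basisVec a := by
  ext b
  simp [basisVec, Finset.sum_apply, Pi.single_apply]

variable [IsManifold (𝓡 d) ∞ X]

theorem SemiRiemannianMetric.components_symm (g : SemiRiemannianMetric d X)
    (e : OpenPartialHomeomorph X (E d)) (u : E d) (a b : Fin d) :
    g.components e u a b = g.components e u b a :=
  g.symm _ _ _

/-- The differential of the inverse chart is bijective, so a kernel vector of the component matrix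
would give a nonzero tangent vector orthogonal to every coordinate vector, hence to the whole
tangent space. -/
theorem SemiRiemannianMetric.det_components_ne_zero (g : SemiRiemannianMetric d X)
    {e : OpenPartialHomeomorph X (E d)} (he : e ∈ IsManifold.maximalAtlas (𝓡 d) ∞ X)
    {u : E d} (hu : u ∈ e.target) : (g.components e u).det ≠ 0 := by
  intro hdet
  obtain ⟨c, hc, hc0⟩ := Matrix.exists_mulVec_eq_zero_iff.2 hdet
  have hbij := (mdifferentiable_of_mem_maximalAtlas he).symm.mfderiv_bijective hu
  set A : E d →ₗ[ℝ] TangentSpace (𝓡 d) (e.symm u) :=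
    (mfderiv (𝓡 d) (𝓡 d) e.symm u).toLinearMap with hA
  have hAb (a : Fin d) : coordVec e u a = A (basisVec a) := rfl
  have hv : A (WithLp.toLp 2 c) = 0 := by
    apply g.nondegenerate
    intro w
    obtain ⟨w', rfl⟩ : ∃ w', A w' = w := hbij.2 w
    have hw : A w' = ∑ a, w' a • A (basisVec a) := by
      conv_lhs => rw [sum_smul_basisVec w', map_sum]
      simp only [map_smul]
    have hcv : A (WithLp.toLp 2 c) = ∑ a, c a • A (basisVec a) := by
      conv_lhs => rw [sum_smul_basisVec (WithLp.toLp 2 c), map_sum]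
      simp only [map_smul]
    have key (a : Fin d) : g.val (e.symm u) (A (WithLp.toLp 2 c)) (A (basisVec a)) = 0 := by
      have := congrFun hc0 a
      rw [g.symm, hcv]
      simp only [map_sum, map_smul, smul_eq_mul]
      simpa [Matrix.mulVec, dotProduct, components, hAb, mul_comm] using this
    rw [hw]
    simp [key]
  have : WithLp.toLp 2 c = (0 : E d) := hbij.1 (hv.trans (map_zero A).symm)
  exact hc (by simpa using this)

end Manifold

/-! ### Induced coordinates on the jet space -/

section JetCharts

variable {p n : ℕ} {T M : Type*} [TopologicalSpace T] [ChartedSpace (E p) T]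
  [TopologicalSpace M] [ChartedSpace (E n) M]

/-- The two directions live in different types until the base points are identified; comparing them
as maps between model spaces avoids casts. -/
theorem OneJet.mk_congr {t t' : T} {x x' : M}
    {A : TangentSpace (𝓡 p) t →L[ℝ] TangentSpace (𝓡 n) x}
    {A' : TangentSpace (𝓡 p) t' →L[ℝ] TangentSpace (𝓡 n) x'} (ht : t' = t) (hx : x' = x)
    (hA : ∀ v : E p, (show E n from A' v) = (show E n from A v)) :
    OneJet.mk t' x' A' = OneJet.mk t x A := by
  subst ht hx
  have : A' = A := ContinuousLinearMap.ext hA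
  rw [this]

theorem dirMap_basisVec (y : Fin n → Fin p → ℝ) (α : Fin p) (i : Fin n) :
    dirMap y (basisVec α) i = y i α := by
  simp [dirMap, basisVec, Matrix.toLpLin_apply]

/-- The local expression of σ is read through `ofCoords`, while the theorem evaluates σ at the jet
itself. The chart differentials cancel in pairs by the chain rule. -/
theorem OneJet.ofCoords_coords [IsManifold (𝓡 p) ∞ T] [IsManifold (𝓡 n) ∞ M]
    {e : OpenPartialHomeomorph T (E p)} (he : e ∈ IsManifold.maximalAtlas (𝓡 p) ∞ T)
    {f : OpenPartialHomeomorph M (E n)} (hf : f ∈ IsManifold.maximalAtlas (𝓡 n) ∞ M)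
    (q : OneJet p n T M) (hqT : q.time ∈ e.source) (hqM : q.pos ∈ f.source) :
    OneJet.ofCoords e f (q.coords e f) = q := by
  obtain ⟨t, x, A⟩ := q
  have het : e.symm (e t) = t := e.left_inv hqT
  have hfx : f.symm (f x) = x := f.left_inv hqM
  refine OneJet.mk_congr het hfx fun v => ?_
  set e' : E p →L[ℝ] E p := mfderiv (𝓡 p) (𝓡 p) e t with he'
  set f' : E n →L[ℝ] E n := mfderiv (𝓡 n) (𝓡 n) f x with hf'
  set es : E p →L[ℝ] E p := mfderiv (𝓡 p) (𝓡 p) e.symm (e t) with hes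
  set fs : E n →L[ℝ] E n := mfderiv (𝓡 n) (𝓡 n) f.symm (f x) with hfs
  set A₀ : E p →L[ℝ] E n := A with hA₀
  -- The base point is generalised so that e.symm (e t) can be replaced by t inside a dependent
  -- type.
  have h1 (t' : T) (ht' : t' = t) :
      (show E p →L[ℝ] E p from mfderiv (𝓡 p) (𝓡 p) e t') = e' := by
    subst ht'; rfl
  have h2 (w : E p) : es (e' w) = w :=
    DFunLike.congr_fun ((mdifferentiable_of_mem_maximalAtlas he).symm_comp_deriv hqT) w
  have h3 (w : E n) : fs (f' w) = w :=
    DFunLike.congr_fun ((mdifferentiable_of_mem_maximalAtlas hf).symm_comp_deriv hqM) w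
  have h4 : dirMap (fun i α => f' (A₀ (es (basisVec α))) i) = f' ∘L A₀ ∘L es := by
    ext1 w
    rw [sum_smul_basisVec w, map_sum, map_sum]
    refine Finset.sum_congr rfl fun α _ => ?_
    rw [map_smul, map_smul]
    congr 1
    ext i
    exact dirMap_basisVec _ _ _
  change fs (dirMap (fun i α => f' (A₀ (es (basisVec α))) i)
    ((show E p →L[ℝ] E p from mfderiv (𝓡 p) (𝓡 p) e (e.symm (e t))) v)) = A₀ v
  rw [h1 _ het, h4]
  simp only [ContinuousLinearMap.comp_apply]
  rw [h2, h3]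

end JetCharts

/-! ### Local data, adapted frame and curvature components -/

/-- Regularity of local data over `U × V`. -/
structure LocalData.Regular {p n : ℕ} (D : LocalData p n) (U : Set (E p)) (V : Set (E n)) :
    Prop where
  isOpen_time : IsOpen U
  isOpen_pos : IsOpen V
  h_symm (u : E p) (α β : Fin p) : D.h u α β = D.h u β α
  φ_symm (u : E n) (i j : Fin n) : D.φ u i j = D.φ u j i
  h_smooth (α β : Fin p) : ContDiffOn ℝ ∞ (fun u => D.h u α β) U
  φ_smooth (i j : Fin n) : ContDiffOn ℝ ∞ (fun u => D.φ u i j) V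
  h_det {u : E p} (hu : u ∈ U) : (D.h u).det ≠ 0
  φ_det {u : E n} (hu : u ∈ V) : (D.φ u).det ≠ 0
  σ_smooth : ContDiffOn ℝ ∞ D.σ {z | z.1 ∈ U ∧ z.2.1 ∈ V}

theorem localData_regular {p n : ℕ} {T M : Type*}
    [TopologicalSpace T] [ChartedSpace (E p) T] [IsManifold (𝓡 p) ∞ T]
    [TopologicalSpace M] [ChartedSpace (E n) M] [IsManifold (𝓡 n) ∞ M]
    (h : SemiRiemannianMetric p T) (φ : SemiRiemannianMetric n M)
    {σ : OneJet p n T M → ℝ} (hσ : JetSmooth σ)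
    {e : OpenPartialHomeomorph T (E p)} (he : e ∈ IsManifold.maximalAtlas (𝓡 p) ∞ T)
    {f : OpenPartialHomeomorph M (E n)} (hf : f ∈ IsManifold.maximalAtlas (𝓡 n) ∞ M) :
    (localData h φ σ e f).Regular e.target f.target where
  isOpen_time := e.open_target
  isOpen_pos := f.open_target
  h_symm := h.components_symm e
  φ_symm := φ.components_symm f
  h_smooth := h.smooth e he
  φ_smooth := φ.smooth f hf
  h_det := h.det_components_ne_zero he
  φ_det := φ.det_components_ne_zero hf
  σ_smooth := hσ e he f hf

namespace LocalData

variable {p n : ℕ} (D : LocalData p n)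

@[simp]
theorem basisVec_apply {d : ℕ} (a b : Fin d) :
    (basisVec a : E d) b = if b = a then 1 else 0 := by
  simp [basisVec]

theorem sum_ddy_apply (c : Fin n → Fin p → ℝ) :
    ∑ j, ∑ β, c j β • (ddy j β : Coord p n) = (0, 0, c) := by
  simp only [ddy, Prod.smul_mk, smul_zero]
  refine Prod.ext ?_ (Prod.ext ?_ ?_)
  · simp [Prod.fst_sum]
  · simp [Prod.fst_sum, Prod.snd_sum]
  · funext i α
    simp [Prod.snd_sum, Finset.sum_apply, Pi.single_apply, ite_apply]

theorem frame_time (α : Fin p) (z : Coord p n) :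
    D.frame (.inl α) z = (basisVec α, 0, fun j β => -D.nlM j β α z) := by
  simp only [frame, sum_ddy_apply]
  ext <;> simp [ddt]

theorem frame_pos (i : Fin n) (z : Coord p n) :
    D.frame (.inr (.inl i)) z = (0, basisVec i, fun j β => -D.nlN j β i z) := by
  simp only [frame, sum_ddy_apply]
  ext <;> simp [ddx]

theorem frame_vert (i : Fin n) (α : Fin p) (z : Coord p n) :
    D.frame (.inr (.inr (i, α))) z = ddy i α := rfl

theorem coframe_frame (A B : Idx p n) (z : Coord p n) :
    D.coframe A z (D.frame B z) = if A = B then 1 else 0 := by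
  rcases A with α | i | ⟨i, α⟩ <;> rcases B with β | j | ⟨j, β⟩ <;>
    simp [frame_time, frame_pos, frame_vert, coframe, ddy, Pi.single_apply, ite_apply, ite_and,
      Prod.ext_iff]

theorem coframe_add (A : Idx p n) (z v w : Coord p n) :
    D.coframe A z (v + w) = D.coframe A z v + D.coframe A z w := by
  rcases A with α | i | ⟨i, α⟩ <;>
    simp [coframe, mul_add, Finset.sum_add_distrib]
  ring

theorem coframe_smul (A : Idx p n) (z : Coord p n) (c : ℝ) (v : Coord p n) :
    D.coframe A z (c • v) = c * D.coframe A z v := by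
  rcases A with α | i | ⟨i, α⟩ <;>
    simp [coframe, mul_add, Finset.mul_sum, mul_left_comm]

/-- The coframe covector as a linear map. -/
noncomputable def coframeLin (A : Idx p n) (z : Coord p n) : Coord p n →ₗ[ℝ] ℝ where
  toFun := D.coframe A z
  map_add' := D.coframe_add A z
  map_smul' := D.coframe_smul A z

theorem coframe_sub (A : Idx p n) (z v w : Coord p n) :
    D.coframe A z (v - w) = D.coframe A z v - D.coframe A z w :=
  map_sub (D.coframeLin A z) v w

theorem coframe_sum_frame (A : Idx p n) (z : Coord p n) (c : Idx p n → ℝ) :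
    D.coframe A z (∑ B, c B • D.frame B z) = c A := by
  have := map_sum (D.coframeLin A z) (fun B => c B • D.frame B z) Finset.univ
  refine this.trans ?_
  have (B : Idx p n) : D.coframeLin A z (c B • D.frame B z) = if A = B then c B else 0 := by
    change D.coframe A z _ = _
    rw [coframe_smul, coframe_frame]
    simp
  simp [this]

theorem nabla_frame (V : Coord p n → Coord p n) (A : Idx p n) (z : Coord p n) :
    D.nabla V (D.frame A) z =
      ∑ F, (∑ B, D.conn F A B z * D.coframe B z (V z)) • D.frame F z := by
  simp [nabla, coframe_frame]

theorem nabla_frame_frame (A B : Idx p n) :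
    D.nabla (D.frame B) (D.frame A) = fun z => ∑ F, D.conn F A B z • D.frame F z := by
  funext z
  simp [nabla_frame, coframe_frame]

/-- No differentiability is needed: the coframe components of the combination are identically the
coefficient functions. -/
theorem nabla_frame_sum (B : Idx p n) (c : Idx p n → Coord p n → ℝ) (z : Coord p n) :
    D.nabla (D.frame B) (fun w => ∑ F, c F w • D.frame F w) z =
      ∑ F, (D.der B (c F) z + ∑ A, D.conn F A B z * c A z) • D.frame F z := by
  simp only [nabla, coframe_sum_frame, coframe_frame, der, mul_ite, mul_one, mul_zero,
    Finset.sum_ite_eq', Finset.mem_univ, if_true]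

/-- The usual structure formula in a nonholonomic frame; the last sum is the bracket correction,
absent in a coordinate frame. -/
theorem curvComp_eq (F A B C : Idx p n) (z : Coord p n) :
    D.curvComp F A B C z =
      D.der C (D.conn F A B) z - D.der B (D.conn F A C) z +
      ∑ K, (D.conn F K C z * D.conn K A B z - D.conn F K B z * D.conn K A C z) -
      ∑ K, D.conn F A K z *
        D.coframe K z (VectorField.lieBracket ℝ (D.frame C) (D.frame B) z) := by
  simp only [curvComp, curv, nabla_frame_frame, nabla_frame_sum, nabla_frame, coframe_sub,
    coframe_sum_frame, Finset.sum_sub_distrib]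
  ring

end LocalData

/-! ### Levi-Civita calculus in coordinates -/

/-- A field of symmetric invertible matrices on `ℝ^d`, smooth on the open set `V`. -/
structure SmoothMetricOn {d : ℕ} (g : E d → Matrix (Fin d) (Fin d) ℝ) (V : Set (E d)) :
    Prop where
  isOpen : IsOpen V
  symm (u : E d) (i j : Fin d) : g u i j = g u j i
  smooth (i j : Fin d) : ContDiffOn ℝ ∞ (fun u => g u i j) V
  det_ne_zero {u : E d} (hu : u ∈ V) : (g u).det ≠ 0

theorem contDiffAt_det {F : Type*} [NormedAddCommGroup F] [NormedSpace ℝ F] {d : ℕ}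
    {A : F → Matrix (Fin d) (Fin d) ℝ} {u : F}
    (hA : ∀ i j, ContDiffAt ℝ ∞ (fun w => A w i j) u) :
    ContDiffAt ℝ ∞ (fun w => (A w).det) u := by
  simp only [Matrix.det_apply]
  exact ContDiffAt.sum fun τ _ => (contDiffAt_prod fun i _ => hA _ _).const_smul _

theorem contDiffAt_matrix_inv {F : Type*} [NormedAddCommGroup F] [NormedSpace ℝ F] {d : ℕ}
    {A : F → Matrix (Fin d) (Fin d) ℝ} {u : F}
    (hA : ∀ i j, ContDiffAt ℝ ∞ (fun w => A w i j) u) (hdet : (A u).det ≠ 0) (i j : Fin d) :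
    ContDiffAt ℝ ∞ (fun w => (A w)⁻¹ i j) u := by
  simp only [Matrix.inv_def, Ring.inverse_eq_inv', Matrix.smul_apply, Matrix.adjugate_apply,
    smul_eq_mul]
  refine ((contDiffAt_det hA).inv hdet).mul (contDiffAt_det fun a b => ?_)
  simp only [Matrix.updateRow_apply]
  split_ifs
  · exact contDiffAt_const
  · exact hA _ _

theorem contDiffAt_pd {d : ℕ} {F : E d → ℝ} {u : E d} (hF : ContDiffAt ℝ ∞ F u) (a : Fin d) :
    ContDiffAt ℝ ∞ (pd a F) u :=
  (hF.fderiv_right (m := ∞) (by simp)).clm_apply contDiffAt_const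

namespace SmoothMetricOn

variable {d : ℕ} {g : E d → Matrix (Fin d) (Fin d) ℝ} {V : Set (E d)}

theorem transpose (hg : SmoothMetricOn g V) (u : E d) : (g u).transpose = g u := by
  ext i j
  exact hg.symm u j i

theorem inv_symm (hg : SmoothMetricOn g V) (u : E d) (i j : Fin d) :
    (g u)⁻¹ i j = (g u)⁻¹ j i := by
  conv_lhs => rw [← hg.transpose u, ← Matrix.transpose_nonsing_inv]
  rfl

theorem inv_mul (hg : SmoothMetricOn g V) {u : E d} (hu : u ∈ V) : (g u)⁻¹ * g u = 1 :=
  Matrix.nonsing_inv_mul _ (isUnit_iff_ne_zero.2 (hg.det_ne_zero hu))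

theorem mul_inv (hg : SmoothMetricOn g V) {u : E d} (hu : u ∈ V) : g u * (g u)⁻¹ = 1 :=
  Matrix.mul_nonsing_inv _ (isUnit_iff_ne_zero.2 (hg.det_ne_zero hu))

theorem contDiffAt (hg : SmoothMetricOn g V) {u : E d} (hu : u ∈ V) (i j : Fin d) :
    ContDiffAt ℝ ∞ (fun w => g w i j) u :=
  (hg.smooth i j).contDiffAt (hg.isOpen.mem_nhds hu)

theorem contDiffAt_inv (hg : SmoothMetricOn g V) {u : E d} (hu : u ∈ V) (i j : Fin d) :
    ContDiffAt ℝ ∞ (fun w => (g w)⁻¹ i j) u :=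
  contDiffAt_matrix_inv (hg.contDiffAt hu) (hg.det_ne_zero hu) i j

theorem contDiffAt_christoffel (hg : SmoothMetricOn g V) {u : E d} (hu : u ∈ V)
    (k i j : Fin d) : ContDiffAt ℝ ∞ (christoffel g k i j) u := by
  unfold christoffel
  refine contDiffAt_const.mul (ContDiffAt.sum fun m _ => (hg.contDiffAt_inv hu k m).mul ?_)
  exact ((contDiffAt_pd (hg.contDiffAt hu j m) i).add (contDiffAt_pd (hg.contDiffAt hu i m) j)).sub
    (contDiffAt_pd (hg.contDiffAt hu i j) m)

theorem christoffel_symm (hg : SmoothMetricOn g V) (k i j : Fin d) :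
    christoffel g k i j = christoffel g k j i := by
  funext u
  have : (fun w => g w i j) = fun w => g w j i := funext fun w => hg.symm w i j
  simp only [christoffel, this, add_comm]

theorem sum_mul_christoffel (hg : SmoothMetricOn g V) {u : E d} (hu : u ∈ V) (l i j : Fin d) :
    ∑ k, g u l k * christoffel g k i j u =
      1 / 2 * (pd i (fun w => g w j l) u + pd j (fun w => g w i l) u -
        pd l (fun w => g w i j) u) := by
  set t : Fin d → ℝ := fun m => pd i (fun w => g w j m) u + pd j (fun w => g w i m) u -
        pd m (fun w => g w i j) u with ht
  have h1 : ∀ k, christoffel g k i j u = 1 / 2 * ((g u)⁻¹.mulVec t) k := fun k => rfl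
  have h2 : (g u).mulVec ((g u)⁻¹.mulVec t) = t := by
    rw [Matrix.mulVec_mulVec, hg.mul_inv hu, Matrix.one_mulVec]
  have h3 := congrFun h2 l
  simp only [h1, mul_left_comm _ (1 / 2 : ℝ), ← Finset.mul_sum]
  congr 1

/-- Metric compatibility of the Levi-Civita connection. -/
theorem pd_metric (hg : SmoothMetricOn g V) {u : E d} (hu : u ∈ V) (k i j : Fin d) :
    pd k (fun w => g w i j) u =
      ∑ m, christoffel g m i k u * g u m j + ∑ m, christoffel g m j k u * g u m i := by
  have h1 := hg.sum_mul_christoffel hu j i k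
  have h2 := hg.sum_mul_christoffel hu i j k
  have h3 : (fun w => g w j i) = fun w => g w i j := funext fun w => hg.symm w j i
  have h4 : (fun w => g w k i) = fun w => g w i k := funext fun w => hg.symm w k i
  have h5 : (fun w => g w k j) = fun w => g w j k := funext fun w => hg.symm w k j
  have e1 : ∑ m, christoffel g m i k u * g u m j = ∑ m, g u j m * christoffel g m i k u :=
    Finset.sum_congr rfl fun m _ => by rw [hg.symm u m j, mul_comm]
  have e2 : ∑ m, christoffel g m j k u * g u m i = ∑ m, g u i m * christoffel g m j k u :=
    Finset.sum_congr rfl fun m _ => by rw [hg.symm u m i, mul_comm]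
  rw [e1, e2, h1, h2, h3, h4, h5]
  ring

/-- Differentiating g⁻¹g = 1 gives d(g⁻¹) = −g⁻¹ (dg) g⁻¹, and metric compatibility reads dg = Γg +
gΓᵀ in matrix form. -/
theorem pd_inv (hg : SmoothMetricOn g V) {u : E d} (hu : u ∈ V) (k i j : Fin d) :
    pd k (fun w => (g w)⁻¹ i j) u =
      -∑ m, christoffel g i m k u * (g u)⁻¹ m j - ∑ m, christoffel g j m k u * (g u)⁻¹ m i := by
  set dψ : Matrix (Fin d) (Fin d) ℝ := Matrix.of fun a b => pd k (fun w => (g w)⁻¹ a b) u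
    with hdψ
  set dφ : Matrix (Fin d) (Fin d) ℝ := Matrix.of fun a b => pd k (fun w => g w a b) u with hdφ
  set Γ : Matrix (Fin d) (Fin d) ℝ := Matrix.of fun a m => christoffel g m a k u with hΓ
  have hφ : dφ = Γ * g u + g u * Γ.transpose := by
    ext a b
    simp only [hdφ, hΓ, Matrix.of_apply, Matrix.add_apply, Matrix.mul_apply,
      Matrix.transpose_apply, hg.pd_metric hu]
    congr 1
    exact Finset.sum_congr rfl fun m _ => by rw [hg.symm u m a, mul_comm]
  have hprod : dψ * g u + (g u)⁻¹ * dφ = 0 := by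
    ext a c
    -- Invertibility is known only on V, so the identity to be differentiated is an identity of
    -- germs.
    have hev : (fun w => ∑ b, (g w)⁻¹ a b * g w b c) =ᶠ[nhds u]
        fun _ => (1 : Matrix (Fin d) (Fin d) ℝ) a c := by
      filter_upwards [hg.isOpen.mem_nhds hu] with w hw
      rw [← hg.inv_mul hw, Matrix.mul_apply]
    have hd := hev.fderiv_eq (𝕜 := ℝ)
    have hi (b : Fin d) := (hg.contDiffAt_inv hu a b).differentiableAt (by simp)
    have hm (b : Fin d) := (hg.contDiffAt hu b c).differentiableAt (by simp)
    rw [fderiv_fun_sum fun b _ => (hi b).fun_mul (hm b)] at hd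
    have hd' := congrArg (fun L => L (basisVec k)) hd
    simp only [_root_.sum_apply, fderiv_fun_mul (hi _) (hm _),
      _root_.add_apply, _root_.smul_apply, smul_eq_mul,
      fderiv_fun_const, Pi.zero_apply, _root_.zero_apply,
      Finset.sum_add_distrib] at hd'
    simp only [Matrix.add_apply, Matrix.mul_apply, hdψ, hdφ, Matrix.of_apply, Matrix.zero_apply,
      pd]
    rw [← hd', add_comm]
    congr 1
    exact Finset.sum_congr rfl fun b _ => mul_comm _ _
  have hfin : dψ = -(Γ.transpose * (g u)⁻¹) - (g u)⁻¹ * Γ := by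
    have h1 : dψ = dψ * g u * (g u)⁻¹ := by
      rw [Matrix.mul_assoc, hg.mul_inv hu, Matrix.mul_one]
    rw [h1, eq_neg_of_add_eq_zero_left hprod, hφ, Matrix.mul_add, neg_add, Matrix.add_mul,
      Matrix.neg_mul, Matrix.neg_mul, Matrix.mul_assoc, Matrix.mul_assoc, hg.mul_inv hu,
      Matrix.mul_one, ← Matrix.mul_assoc, hg.inv_mul hu, Matrix.one_mul]
    abel
  have := congrFun (congrFun hfin i) j
  simp only [hdψ, hΓ, Matrix.of_apply, Matrix.sub_apply, Matrix.neg_apply, Matrix.mul_apply,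
    Matrix.transpose_apply] at this
  rw [this]
  congr 1
  exact Finset.sum_congr rfl fun m _ => by rw [hg.inv_symm u i m, mul_comm]

end SmoothMetricOn

theorem riemann_antisymm {d : ℕ} (g : E d → Matrix (Fin d) (Fin d) ℝ) (l i j k : Fin d)
    (u : E d) : riemann g l i j k u = -riemann g l i k j u := by
  simp only [riemann, Finset.sum_sub_distrib]
  ring

theorem LocalData.Regular.metric_h {p n : ℕ} {D : LocalData p n} {U : Set (E p)} {V : Set (E n)}
    (hD : D.Regular U V) : SmoothMetricOn D.h U :=
  ⟨hD.isOpen_time, hD.h_symm, hD.h_smooth, hD.h_det⟩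

theorem LocalData.Regular.metric_φ {p n : ℕ} {D : LocalData p n} {U : Set (E p)} {V : Set (E n)}
    (hD : D.Regular U V) : SmoothMetricOn D.φ V :=
  ⟨hD.isOpen_pos, hD.φ_symm, hD.φ_smooth, hD.φ_det⟩

/-! ### The conformal difference tensor -/

/-- The difference between the Christoffel symbols of `e^{2σ} φ` and `φ`, where `a = dσ`. -/
noncomputable def conf {n : ℕ} (φ : Matrix (Fin n) (Fin n) ℝ) (a : Fin n → ℝ)
    (k i j : Fin n) : ℝ :=
  (if k = i then a j else 0) + (if k = j then a i else 0) - φ i j * ∑ m, φ⁻¹ k m * a m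

/-- The left side is what the Koszul-type formulas for L and C produce from the derivative of
e^{2σ}, once the exponentials have cancelled. -/
theorem half_sum_inv_mul {n : ℕ} {φ : Matrix (Fin n) (Fin n) ℝ} (hφ : φ⁻¹ * φ = 1)
    (hs : ∀ i j, φ i j = φ j i) (a : Fin n → ℝ) (k i j : Fin n) :
    1 / 2 * ∑ m, φ⁻¹ k m * (2 * a j * φ i m + 2 * a i * φ j m - 2 * a m * φ i j) =
      conf φ a k i j := by
  have h1 (i : Fin n) : ∑ m, φ⁻¹ k m * φ i m = if k = i then 1 else 0 := by
    rw [← Matrix.one_apply, ← hφ, Matrix.mul_apply]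
    exact Finset.sum_congr rfl fun m _ => by rw [hs]
  have h2 : ∑ m, φ⁻¹ k m * (2 * a j * φ i m + 2 * a i * φ j m - 2 * a m * φ i j) =
      2 * a j * ∑ m, φ⁻¹ k m * φ i m + 2 * a i * ∑ m, φ⁻¹ k m * φ j m -
        2 * (φ i j * ∑ m, φ⁻¹ k m * a m) := by
    simp only [Finset.mul_sum, ← Finset.sum_add_distrib, ← Finset.sum_sub_distrib]
    exact Finset.sum_congr rfl fun m _ => by ring
  rw [h2, h1, h1, conf]
  split_ifs <;> ring

/-- This is the Leibniz rule for a tensor made of a and parallel tensors, in pure algebra: Γ stands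
for the Christoffel symbols in one fixed direction and da for the derivative of a, while the
derivatives of φ and φ⁻¹ have been replaced using `pd_metric` and `pd_inv`. -/
theorem conf_covariant {n : ℕ} {φ : Matrix (Fin n) (Fin n) ℝ} (hs : ∀ i j, φ i j = φ j i)
    (hsi : ∀ i j, φ⁻¹ i j = φ⁻¹ j i) (Γ : Fin n → Fin n → ℝ) (a da : Fin n → ℝ) (l i j : Fin n) :
    conf φ da l i j - (∑ m, Γ m i * φ m j + ∑ m, Γ m j * φ m i) * ∑ m, φ⁻¹ l m * a m -
        φ i j * ∑ m, (-∑ r, Γ l r * φ⁻¹ r m - ∑ r, Γ m r * φ⁻¹ r l) * a m =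
      conf φ (fun r => da r - ∑ m, a m * Γ m r) l i j - ∑ m, Γ l m * conf φ a m i j +
        ∑ m, Γ m i * conf φ a l m j + ∑ m, Γ m j * conf φ a l i m := by
  have h1 : ∑ m, Γ l m * conf φ a m i j =
      Γ l i * a j + Γ l j * a i - φ i j * ∑ m, Γ l m * ∑ r, φ⁻¹ m r * a r := by
    simp only [conf, mul_sub, mul_add, Finset.sum_sub_distrib, Finset.sum_add_distrib, mul_ite,
      mul_zero, Finset.sum_ite_eq', Finset.mem_univ, if_true]
    rw [Finset.mul_sum]
    congr 1
    exact Finset.sum_congr rfl fun m _ => by ring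
  have h2 (i j : Fin n) : ∑ m, Γ m i * conf φ a l m j =
      Γ l i * a j + (if l = j then ∑ m, Γ m i * a m else 0) -
        (∑ m, Γ m i * φ m j) * ∑ m, φ⁻¹ l m * a m := by
    simp only [conf, mul_sub, mul_add, Finset.sum_sub_distrib, Finset.sum_add_distrib, mul_ite,
      mul_zero, Finset.sum_ite_eq, Finset.mem_univ, if_true, Finset.sum_mul, ← mul_assoc]
    congr 2
    split_ifs <;> simp
  have h3 : ∑ m, Γ m j * conf φ a l i m = ∑ m, Γ m j * conf φ a l m i :=
    Finset.sum_congr rfl fun m _ => by simp only [conf, hs i m]; ring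
  have h4 : conf φ (fun r => da r - ∑ m, a m * Γ m r) l i j = conf φ da l i j -
      ((if l = i then ∑ m, Γ m j * a m else 0) + (if l = j then ∑ m, Γ m i * a m else 0)) +
      φ i j * ∑ r, φ⁻¹ l r * ∑ m, a m * Γ m r := by
    simp only [conf, mul_sub, Finset.sum_sub_distrib, mul_comm (Γ _ _)]
    split_ifs <;> ring
  have h5 : ∑ m, (-∑ r, Γ l r * φ⁻¹ r m - ∑ r, Γ m r * φ⁻¹ r l) * a m =
      -∑ m, Γ l m * ∑ r, φ⁻¹ m r * a r - ∑ r, φ⁻¹ l r * ∑ m, a m * Γ m r := by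
    simp only [sub_mul, neg_mul, Finset.sum_sub_distrib, Finset.sum_neg_distrib, Finset.sum_mul,
      Finset.mul_sum]
    rw [Finset.sum_comm]
    congr 1
    · simp only [mul_assoc]
    · rw [Finset.sum_comm]
      exact Finset.sum_congr rfl fun m _ => Finset.sum_congr rfl fun r _ => by
        rw [hsi m l]; ring
  rw [h1, h2, h3, h2, h4, h5]
  ring

/-! ### Derivatives along the frame and the Cartan coefficients -/

namespace LocalData

variable {p n : ℕ} {D : LocalData p n} {U : Set (E p)} {V : Set (E n)}

section Derivation

variable {A : Idx p n} {F G : Coord p n → ℝ} {z : Coord p n}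

theorem der_add (hF : DifferentiableAt ℝ F z) (hG : DifferentiableAt ℝ G z) :
    D.der A (fun w => F w + G w) z = D.der A F z + D.der A G z := by
  simp [der, fderiv_fun_add hF hG]

theorem der_sub (hF : DifferentiableAt ℝ F z) (hG : DifferentiableAt ℝ G z) :
    D.der A (fun w => F w - G w) z = D.der A F z - D.der A G z := by
  simp [der, fderiv_fun_sub hF hG]

theorem der_mul (hF : DifferentiableAt ℝ F z) (hG : DifferentiableAt ℝ G z) :
    D.der A (fun w => F w * G w) z = D.der A F z * G z + F z * D.der A G z := by
  simp [der, fderiv_fun_mul hF hG]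
  ring

theorem der_const (c : ℝ) : D.der A (fun _ => c) z = 0 := by
  simp [der]

theorem der_sum {ι : Type*} {s : Finset ι} {F : ι → Coord p n → ℝ}
    (hF : ∀ i ∈ s, DifferentiableAt ℝ (F i) z) :
    D.der A (fun w => ∑ i ∈ s, F i w) z = ∑ i ∈ s, D.der A (F i) z := by
  simp [der, fderiv_fun_sum hF]

theorem der_congr (h : F =ᶠ[nhds z] G) : D.der A F z = D.der A G z := by
  simp only [der, h.fderiv_eq]

theorem der_comp_time {f : E p → ℝ} (hf : DifferentiableAt ℝ f z.1) :
    D.der A (fun w => f w.1) z = fderiv ℝ f z.1 (D.frame A z).1 := by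
  have := hf.hasFDerivAt.comp z (hasFDerivAt_fst (𝕜 := ℝ))
  exact DFunLike.congr_fun this.fderiv _

theorem der_comp_pos {f : E n → ℝ} (hf : DifferentiableAt ℝ f z.2.1) :
    D.der A (fun w => f w.2.1) z = fderiv ℝ f z.2.1 (D.frame A z).2.1 := by
  have h1 : HasFDerivAt (fun w : Coord p n => w.2.1) _ z :=
    ((ContinuousLinearMap.fst ℝ (E n) (Fin n → Fin p → ℝ)).comp
      (ContinuousLinearMap.snd ℝ (E p) (E n × (Fin n → Fin p → ℝ)))).hasFDerivAt
  have := hf.hasFDerivAt.comp z h1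
  exact DFunLike.congr_fun this.fderiv _

theorem der_dir (i : Fin n) (α : Fin p) :
    D.der A (fun w => w.2.2 i α) z = (D.frame A z).2.2 i α := by
  have h1 : HasFDerivAt (fun w : Coord p n => w.2.2 i α) _ z :=
    ((ContinuousLinearMap.proj (R := ℝ) (φ := fun _ : Fin p => ℝ) α).comp
      ((ContinuousLinearMap.proj (R := ℝ) (φ := fun _ : Fin n => Fin p → ℝ) i).comp
      ((ContinuousLinearMap.snd ℝ (E n) (Fin n → Fin p → ℝ)).comp
      (ContinuousLinearMap.snd ℝ (E p) (E n × (Fin n → Fin p → ℝ)))))).hasFDerivAt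
  exact DFunLike.congr_fun h1.fderiv _

theorem der_time_comp_time {f : E p → ℝ} (hf : DifferentiableAt ℝ f z.1) (α : Fin p) :
    D.der (.inl α) (fun w => f w.1) z = pd α f z.1 := by
  rw [der_comp_time hf, frame_time, pd]

theorem der_pos_comp_pos {f : E n → ℝ} (hf : DifferentiableAt ℝ f z.2.1) (i : Fin n) :
    D.der (.inr (.inl i)) (fun w => f w.2.1) z = pd i f z.2.1 := by
  rw [der_comp_pos hf, frame_pos, pd]

theorem der_vert_comp_pos {f : E n → ℝ} (hf : DifferentiableAt ℝ f z.2.1) (i : Fin n)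
    (α : Fin p) : D.der (.inr (.inr (i, α))) (fun w => f w.2.1) z = 0 := by
  rw [der_comp_pos hf, frame_vert, ddy, map_zero]

end Derivation

theorem differentiableAt_comp_pos {f : E n → ℝ} (hf : DifferentiableAt ℝ f z.2.1) :
    DifferentiableAt ℝ (fun w : Coord p n => f w.2.1) z :=
  DifferentiableAt.comp z hf (by fun_prop)

/-- Valid for singular φ as well, where both matrix inverses are zero by convention. -/
theorem g_inv (D : LocalData p n) (z : Coord p n) :
    (D.g z)⁻¹ = Real.exp (-(2 * D.σ z)) • (D.φ z.2.1)⁻¹ := by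
  by_cases hdet : IsUnit (D.φ z.2.1).det
  · refine Matrix.inv_eq_right_inv ?_
    rw [g, Matrix.smul_mul, Matrix.mul_smul, smul_smul, ← Real.exp_add,
      Matrix.mul_nonsing_inv _ hdet]
    simp
  · rw [g, Matrix.nonsing_inv_apply_not_isUnit _ hdet, Matrix.nonsing_inv_apply_not_isUnit,
      smul_zero]
    simpa [Matrix.det_smul] using hdet

theorem exp_cancel (D : LocalData p n) (z : Coord p n) (c t : ℝ) :
    Real.exp (-(2 * D.σ z)) * c * (Real.exp (2 * D.σ z) * t) = c * t := by
  have : Real.exp (-(2 * D.σ z)) * Real.exp (2 * D.σ z) = 1 := by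
    rw [← Real.exp_add]; simp
  linear_combination c * t * this

namespace Regular

variable (hD : D.Regular U V) {z : Coord p n} (hz : z.1 ∈ U ∧ z.2.1 ∈ V)
include hD hz

theorem eventually : ∀ᶠ w in nhds z, w.1 ∈ U ∧ w.2.1 ∈ V := by
  have h1 : IsOpen {w : Coord p n | w.1 ∈ U ∧ w.2.1 ∈ V} :=
    (hD.isOpen_time.preimage continuous_fst).inter
      (hD.isOpen_pos.preimage (continuous_fst.comp continuous_snd))
  exact h1.mem_nhds hz

theorem contDiffAt_σ : ContDiffAt ℝ ∞ D.σ z :=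
  hD.σ_smooth.contDiffAt (hD.eventually hz)

theorem contDiffAt_nlM (i : Fin n) (α β : Fin p) : ContDiffAt ℝ ∞ (D.nlM i α β) z := by
  unfold nlM
  refine ContDiffAt.neg (ContDiffAt.sum fun μ _ => ContDiffAt.mul ?_ (by fun_prop))
  exact (hD.metric_h.contDiffAt_christoffel hz.1 μ α β).comp z contDiffAt_fst

theorem contDiffAt_nlN (i : Fin n) (α : Fin p) (j : Fin n) :
    ContDiffAt ℝ ∞ (D.nlN i α j) z := by
  unfold nlN
  refine ContDiffAt.sum fun μ _ => ContDiffAt.mul ?_ (by fun_prop)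
  have h1 : ContDiffAt ℝ ∞ (fun w : Coord p n => w.2.1) z := by fun_prop
  exact ContDiffAt.comp (g := christoffel D.φ i j μ) (f := fun w : Coord p n => w.2.1) z
    (hD.metric_φ.contDiffAt_christoffel hz.2 i j μ) h1

theorem contDiffAt_frame (A : Idx p n) : ContDiffAt ℝ ∞ (D.frame A) z := by
  rcases A with α | i | ⟨i, α⟩
  · simp only [funext (D.frame_time α)]
    refine contDiffAt_const.prodMk (contDiffAt_const.prodMk ?_)
    exact contDiffAt_pi.2 fun j => contDiffAt_pi.2 fun β => (hD.contDiffAt_nlM hz j β α).neg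
  · simp only [funext (D.frame_pos i)]
    refine contDiffAt_const.prodMk (contDiffAt_const.prodMk ?_)
    exact contDiffAt_pi.2 fun j => contDiffAt_pi.2 fun β => (hD.contDiffAt_nlN hz j β i).neg
  · exact contDiffAt_const

theorem contDiffAt_der (A : Idx p n) {F : Coord p n → ℝ} (hF : ContDiffAt ℝ ∞ F z) :
    ContDiffAt ℝ ∞ (D.der A F) z :=
  (hF.fderiv_right (m := ∞) (by simp)).clm_apply (hD.contDiffAt_frame hz A)

theorem differentiableAt_sigH (k : Fin n) : DifferentiableAt ℝ (D.sigH k) z :=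
  (hD.contDiffAt_der hz _ (hD.contDiffAt_σ hz)).differentiableAt (by simp)

theorem differentiableAt_sigV (k : Fin n) (γ : Fin p) : DifferentiableAt ℝ (D.sigV k γ) z :=
  (hD.contDiffAt_der hz _ (hD.contDiffAt_σ hz)).differentiableAt (by simp)

theorem differentiableAt_φ (i j : Fin n) : DifferentiableAt ℝ (fun u => D.φ u i j) z.2.1 :=
  (hD.metric_φ.contDiffAt hz.2 i j).differentiableAt (by simp)

theorem differentiableAt_φ_inv (i j : Fin n) :
    DifferentiableAt ℝ (fun u => (D.φ u)⁻¹ i j) z.2.1 :=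
  (hD.metric_φ.contDiffAt_inv hz.2 i j).differentiableAt (by simp)

theorem differentiableAt_christoffel_φ (k i j : Fin n) :
    DifferentiableAt ℝ (christoffel D.φ k i j) z.2.1 :=
  (hD.metric_φ.contDiffAt_christoffel hz.2 k i j).differentiableAt (by simp)

theorem differentiableAt_christoffel_h (k i j : Fin p) :
    DifferentiableAt ℝ (christoffel D.h k i j) z.1 :=
  (hD.metric_h.contDiffAt_christoffel hz.1 k i j).differentiableAt (by simp)

theorem der_g (A : Idx p n) (i j : Fin n) :
    D.der A (fun w => D.g w i j) z = Real.exp (2 * D.σ z) *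
      (2 * D.der A D.σ z * D.φ z.2.1 i j + D.der A (fun w => D.φ w.2.1 i j) z) := by
  have hσ := (hD.contDiffAt_σ hz).differentiableAt (by simp)
  have he : DifferentiableAt ℝ (fun w => Real.exp (2 * D.σ w)) z := by fun_prop
  have h1 : D.der A (fun w => Real.exp (2 * D.σ w)) z =
      Real.exp (2 * D.σ z) * (2 * D.der A D.σ z) := by
    have := ((hσ.hasFDerivAt.const_mul 2).exp).fderiv
    simp [der, this]
  simp only [g, Matrix.smul_apply, smul_eq_mul]
  rw [der_mul he (differentiableAt_comp_pos (hD.differentiableAt_φ hz i j)), h1]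
  ring

theorem cartanL_eq (k i j : Fin n) :
    D.cartanL k i j z = christoffel D.φ k i j z.2.1 +
      conf (D.φ z.2.1) (fun m => D.sigH m z) k i j := by
  rw [← half_sum_inv_mul (hD.metric_φ.inv_mul hz.2) (hD.φ_symm _)]
  simp only [cartanL, D.g_inv, hD.der_g hz, der_pos_comp_pos (hD.differentiableAt_φ hz _ _),
    christoffel, ← mul_add, ← mul_sub, Matrix.smul_apply, smul_eq_mul, D.exp_cancel z,
    ← Finset.sum_add_distrib, sigH]
  congr 1
  exact Finset.sum_congr rfl fun m _ => by ring

/-- No Christoffel term appears because φ does not depend on the fibre coordinates. -/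
theorem cartanC_eq (k i j : Fin n) (γ : Fin p) :
    D.cartanC k i j γ z = conf (D.φ z.2.1) (fun m => D.sigV m γ z) k i j := by
  rw [← half_sum_inv_mul (hD.metric_φ.inv_mul hz.2) (hD.φ_symm _)]
  simp only [cartanC, D.g_inv, hD.der_g hz, der_vert_comp_pos (hD.differentiableAt_φ hz _ _),
    ← mul_add, ← mul_sub, Matrix.smul_apply, smul_eq_mul, D.exp_cancel z, sigV]
  congr 1
  exact Finset.sum_congr rfl fun m _ => by ring

theorem differentiableAt_conf {s : Fin n → Coord p n → ℝ}
    (hs : ∀ m, DifferentiableAt ℝ (s m) z) (l i j : Fin n) :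
    DifferentiableAt ℝ (fun w => conf (D.φ w.2.1) (fun m => s m w) l i j) z := by
  have h1 := differentiableAt_comp_pos (hD.differentiableAt_φ hz i j)
  have h2 (m : Fin n) := differentiableAt_comp_pos (hD.differentiableAt_φ_inv hz l m)
  unfold conf
  refine DifferentiableAt.sub (DifferentiableAt.add ?_ ?_) (h1.mul ?_)
  · split_ifs
    · exact hs _
    · exact differentiableAt_const _
  · split_ifs
    · exact hs _
    · exact differentiableAt_const _
  · exact DifferentiableAt.fun_sum fun m _ => (h2 m).mul (hs m)

theorem der_conf (A : Idx p n) {s : Fin n → Coord p n → ℝ}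
    (hs : ∀ m, DifferentiableAt ℝ (s m) z) (l i j : Fin n) :
    D.der A (fun w => conf (D.φ w.2.1) (fun m => s m w) l i j) z =
      conf (D.φ z.2.1) (fun m => D.der A (s m) z) l i j -
        D.der A (fun w => D.φ w.2.1 i j) z * ∑ m, (D.φ z.2.1)⁻¹ l m * s m z -
        D.φ z.2.1 i j * ∑ m, D.der A (fun w => (D.φ w.2.1)⁻¹ l m) z * s m z := by
  have h1 := differentiableAt_comp_pos (hD.differentiableAt_φ hz i j)
  have h2 (m : Fin n) := differentiableAt_comp_pos (hD.differentiableAt_φ_inv hz l m)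
  have hite (c : Prop) [Decidable c] (m : Fin n) :
      DifferentiableAt ℝ (fun w => if c then s m w else 0) z := by
    split_ifs
    · exact hs _
    · exact differentiableAt_const _
  have hite' (c : Prop) [Decidable c] (m : Fin n) :
      D.der A (fun w => if c then s m w else 0) z = if c then D.der A (s m) z else 0 := by
    split_ifs
    · rfl
    · exact der_const _
  have hsum : DifferentiableAt ℝ (fun w => ∑ m, (D.φ w.2.1)⁻¹ l m * s m w) z :=
    DifferentiableAt.fun_sum fun m _ => (h2 m).mul (hs m)
  simp only [conf]
  rw [der_sub ((hite _ _).fun_add (hite _ _)) (h1.fun_mul hsum), der_add (hite _ _) (hite _ _),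
    hite', hite', der_mul h1 hsum, der_sum fun m _ => (h2 m).fun_mul (hs m)]
  simp only [der_mul (h2 _) (hs _), Finset.sum_add_distrib]
  ring

theorem der_vert_conf (k : Fin n) (γ : Fin p) {s : Fin n → Coord p n → ℝ}
    (hs : ∀ m, DifferentiableAt ℝ (s m) z) (l i j : Fin n) :
    D.der (.inr (.inr (k, γ))) (fun w => conf (D.φ w.2.1) (fun m => s m w) l i j) z =
      conf (D.φ z.2.1) (fun m => D.der (.inr (.inr (k, γ))) (s m) z) l i j := by
  rw [hD.der_conf hz _ hs]
  simp [der_vert_comp_pos (hD.differentiableAt_φ hz _ _),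
    der_vert_comp_pos (hD.differentiableAt_φ_inv hz _ _)]

/-- The Berwald covariant derivative of `conf a` is `conf` of the covariant derivative of `a`. -/
theorem der_pos_conf (k : Fin n) {s : Fin n → Coord p n → ℝ}
    (hs : ∀ m, DifferentiableAt ℝ (s m) z) (l i j : Fin n) :
    D.der (.inr (.inl k)) (fun w => conf (D.φ w.2.1) (fun m => s m w) l i j) z =
      conf (D.φ z.2.1) (fun r => D.der (.inr (.inl k)) (s r) z -
        ∑ m, s m z * christoffel D.φ m r k z.2.1) l i j -
      ∑ m, christoffel D.φ l m k z.2.1 * conf (D.φ z.2.1) (fun r => s r z) m i j +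
      ∑ m, christoffel D.φ m i k z.2.1 * conf (D.φ z.2.1) (fun r => s r z) l m j +
      ∑ m, christoffel D.φ m j k z.2.1 * conf (D.φ z.2.1) (fun r => s r z) l i m := by
  rw [hD.der_conf hz _ hs]
  simp only [der_pos_comp_pos (hD.differentiableAt_φ hz _ _),
    der_pos_comp_pos (hD.differentiableAt_φ_inv hz _ _), hD.metric_φ.pd_metric hz.2,
    hD.metric_φ.pd_inv hz.2]
  exact conf_covariant (hD.φ_symm z.2.1) (hD.metric_φ.inv_symm z.2.1)
    (fun a b => christoffel D.φ a b k z.2.1) (fun m => s m z)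
    (fun m => D.der (.inr (.inl k)) (s m) z) l i j

end Regular

end LocalData

/-! ### Contractions of the conformal tensor -/

section Trace

variable {n : ℕ} {φ : Matrix (Fin n) (Fin n) ℝ}

theorem mul_inv_mulVec (hφ : φ * φ⁻¹ = 1) (a : Fin n → ℝ) (i : Fin n) :
    ∑ k, φ i k * ∑ m, φ⁻¹ k m * a m = a i := by
  have : φ.mulVec (φ⁻¹.mulVec a) = a := by
    rw [Matrix.mulVec_mulVec, hφ, Matrix.one_mulVec]
  exact congrFun this i

theorem sum_conf_contract (hφ : φ * φ⁻¹ = 1) (a : Fin n → ℝ) (i : Fin n) :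
    ∑ k, conf φ a k i k = n * a i := by
  simp only [conf, Finset.sum_sub_distrib, Finset.sum_add_distrib, mul_inv_mulVec hφ]
  simp

theorem trace_inv_mul (hs : ∀ i j, φ i j = φ j i) (hφ : φ * φ⁻¹ = 1) :
    ∑ i, ∑ j, φ⁻¹ i j * φ i j = n := by
  have h := congrArg Matrix.trace hφ
  rw [Matrix.trace_mul_comm] at h
  simpa [Matrix.trace, Matrix.mul_apply, hs] using h

theorem trace_conf (hs : ∀ i j, φ i j = φ j i) (hsi : ∀ i j, φ⁻¹ i j = φ⁻¹ j i)
    (hφ : φ * φ⁻¹ = 1) (a : Fin n → ℝ) (k : Fin n) :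
    ∑ i, ∑ j, φ⁻¹ i j * conf φ a k i j = (2 - n) * ∑ m, φ⁻¹ k m * a m := by
  simp only [conf, mul_sub, mul_add, Finset.sum_sub_distrib, Finset.sum_add_distrib, ← mul_assoc,
    ← Finset.sum_mul, trace_inv_mul hs hφ]
  simp [hsi _ k]
  ring

theorem sum_mul_conf (a b : Fin n → ℝ) (i j : Fin n) :
    ∑ m, a m * conf φ b m i j =
      a i * b j + a j * b i - φ i j * ∑ r, ∑ m, φ⁻¹ r m * a r * b m := by
  simp only [conf, mul_sub, mul_add, Finset.sum_sub_distrib, Finset.sum_add_distrib, mul_ite,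
    mul_zero, Finset.sum_ite_eq', Finset.mem_univ, if_true, Finset.mul_sum]
  congr 1
  exact Finset.sum_congr rfl fun r _ => Finset.sum_congr rfl fun m _ => by ring

theorem sum_metric_mul_conf (hs : ∀ i j, φ i j = φ j i) (hφ : φ * φ⁻¹ = 1)
    (b : Fin n → ℝ) (i j k : Fin n) :
    ∑ m, φ m j * conf φ b m i k = φ i j * b k + φ k j * b i - φ i k * b j := by
  have h := mul_inv_mulVec hφ b j
  simp only [conf, mul_sub, mul_add, Finset.sum_sub_distrib, Finset.sum_add_distrib, mul_ite,
    mul_zero, Finset.sum_ite_eq', Finset.mem_univ, if_true]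
  rw [← h, Finset.mul_sum]
  congr 1
  exact Finset.sum_congr rfl fun m _ => by rw [hs m j]; ring

theorem sum_conf_mul_conf (hs : ∀ i j, φ i j = φ j i) (hsi : ∀ i j, φ⁻¹ i j = φ⁻¹ j i)
    (hφ : φ * φ⁻¹ = 1) (a b : Fin n → ℝ) (i j : Fin n) :
    ∑ k, ∑ m, conf φ a k m j * conf φ b m i k =
      n * (b i * a j) + 2 * (a i * b j) - 2 * φ i j * ∑ r, ∑ m, φ⁻¹ r m * a r * b m := by
  set up : Fin n → ℝ := fun k => ∑ m, φ⁻¹ k m * a m with hup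
  have h1 (k : Fin n) : ∑ m, conf φ a k m j * conf φ b m i k =
      a j * conf φ b k i k + (if k = j then ∑ m, a m * conf φ b m i k else 0) -
        up k * ∑ m, φ m j * conf φ b m i k := by
    have h0 (m : Fin n) : conf φ a k m j =
        (if k = m then a j else 0) + (if k = j then a m else 0) - φ m j * up k := rfl
    simp only [h0, sub_mul, add_mul, Finset.sum_sub_distrib, Finset.sum_add_distrib,
      ite_mul, zero_mul, Finset.sum_ite_eq, Finset.mem_univ, if_true]
    rw [Finset.mul_sum]
    congr 1
    · congr 1
      split_ifs <;> simp
    · exact Finset.sum_congr rfl fun m _ => by ring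
  have hlow (i : Fin n) : ∑ k, φ i k * up k = a i := mul_inv_mulVec hφ a i
  have hin : ∑ k, up k * b k = ∑ r, ∑ m, φ⁻¹ r m * a r * b m := by
    simp only [hup, Finset.sum_mul]
    rw [Finset.sum_comm]
    exact Finset.sum_congr rfl fun r _ => Finset.sum_congr rfl fun m _ => by rw [hsi]
  have h2 : ∑ k, up k * (φ i j * b k + φ k j * b i - φ i k * b j) =
      φ i j * ∑ r, ∑ m, φ⁻¹ r m * a r * b m + a j * b i - a i * b j := by
    rw [← hlow i, ← hlow j, ← hin, Finset.mul_sum, Finset.sum_mul, Finset.sum_mul,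
      ← Finset.sum_add_distrib, ← Finset.sum_sub_distrib]
    exact Finset.sum_congr rfl fun k _ => by rw [hs k j]; ring
  simp only [h1, Finset.sum_sub_distrib, Finset.sum_add_distrib, sum_metric_mul_conf hs hφ, h2,
    ← Finset.mul_sum, sum_conf_contract hφ, Finset.sum_ite_eq', Finset.mem_univ, if_true,
    sum_mul_conf]
  ring

/-- Of the three terms of `conf`, the first pairs the symmetric φ⁻¹ with an antisymmetric array and
dies. The second gives one copy of the contraction; the third, entering with a minus sign, gives
another after the last two indices of R are swapped. Hence the factor 2. -/
theorem trace_conf_mul_antisymm (hsi : ∀ i j, φ⁻¹ i j = φ⁻¹ j i) (hφ : φ⁻¹ * φ = 1)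
    (a : Fin n → ℝ) {R : Fin n → Fin n → Fin n → ℝ} (hR : ∀ m j k, R m j k = -R m k j) :
    ∑ i, ∑ j, φ⁻¹ i j * ∑ k, ∑ m, conf φ a k i m * R m j k =
      2 * ∑ j, (∑ m, φ⁻¹ j m * a m) * ∑ k, R k j k := by
  set up : Fin n → ℝ := fun k => ∑ m, φ⁻¹ k m * a m with hup
  have h0 (k i m : Fin n) : conf φ a k i m =
      (if k = i then a m else 0) + (if k = m then a i else 0) - φ i m * up k := rfl
  have h1 (i j : Fin n) : ∑ k, ∑ m, conf φ a k i m * R m j k =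
      ∑ m, a m * R m j i + a i * ∑ k, R k j k - ∑ m, φ i m * ∑ k, up k * R m j k := by
    simp only [h0, sub_mul, add_mul, Finset.sum_sub_distrib, Finset.sum_add_distrib, ite_mul,
      zero_mul, Finset.sum_ite_eq, Finset.mem_univ, if_true, Finset.mul_sum]
    congr 1
    · congr 1
      rw [Finset.sum_comm]
      simp
    · rw [Finset.sum_comm]
      simp only [mul_assoc]
  have h2 : ∑ i, ∑ j, φ⁻¹ i j * ∑ m, a m * R m j i = 0 := by
    have : ∑ i, ∑ j, φ⁻¹ i j * ∑ m, a m * R m j i =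
        -∑ i, ∑ j, φ⁻¹ i j * ∑ m, a m * R m j i := by
      conv_lhs => rw [Finset.sum_comm]
      simp only [← Finset.sum_neg_distrib, ← mul_neg]
      refine Finset.sum_congr rfl fun i _ => Finset.sum_congr rfl fun j _ => ?_
      rw [hsi j i]
      exact congrArg _ (Finset.sum_congr rfl fun m _ => by rw [hR m i j])
    linarith
  have h3 : ∑ i, ∑ j, φ⁻¹ i j * (a i * ∑ k, R k j k) = ∑ j, up j * ∑ k, R k j k := by
    rw [Finset.sum_comm]
    simp only [hup, Finset.sum_mul]
    exact Finset.sum_congr rfl fun j _ => Finset.sum_congr rfl fun i _ => by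
      rw [hsi i j, mul_assoc, Finset.mul_sum]
  have h4 : ∑ i, ∑ j, φ⁻¹ i j * ∑ m, φ i m * ∑ k, up k * R m j k =
      -∑ j, up j * ∑ k, R k j k := by
    have h5 (j : Fin n) : ∑ i, φ⁻¹ i j * ∑ m, φ i m * ∑ k, up k * R m j k =
        ∑ k, up k * R j j k := by
      have : φ⁻¹.mulVec (φ.mulVec fun m => ∑ k, up k * R m j k) =
          fun m => ∑ k, up k * R m j k := by
        rw [Matrix.mulVec_mulVec, hφ, Matrix.one_mulVec]
      simp only [hsi _ j]
      exact congrFun this j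
    rw [Finset.sum_comm]
    simp only [h5]
    rw [Finset.sum_comm]
    simp only [← Finset.mul_sum, ← Finset.sum_neg_distrib, ← mul_neg]
    exact Finset.sum_congr rfl fun k _ => congrArg _ (Finset.sum_congr rfl fun j _ => hR j j k)
  simp only [h1, mul_sub, mul_add, Finset.sum_sub_distrib, Finset.sum_add_distrib, h2, h3, h4]
  ring

end Trace

/-! ### Block structure, brackets of the frame and curvature -/

namespace LocalData

variable {p n : ℕ} {D : LocalData p n} {U : Set (E p)} {V : Set (E n)}

section Conn

variable (D)

/-- The summand (temporal, spatial or vertical) that a frame index belongs to. -/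
def kind : Idx p n → Fin 3
  | .inl _ => 0
  | .inr (.inl _) => 1
  | .inr (.inr _) => 2

/-- The connection preserves the temporal, spatial and vertical distributions. -/
theorem conn_eq_zero {F A : Idx p n} (h : kind F ≠ kind A) (B : Idx p n) :
    D.conn F A B = 0 := by
  rcases F with γ | k | ⟨k, γ⟩ <;> rcases A with α | i | ⟨i, α⟩ <;>
    rcases B with β | j | ⟨j, β⟩ <;> first | rfl | exact absurd rfl h

theorem conn_inr_inl (x : Fin n ⊕ (Fin n × Fin p)) (α : Fin p) (B : Idx p n) :
    D.conn (.inr x) (.inl α) B = 0 :=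
  D.conn_eq_zero (by rcases x with k | k <;> simp [kind]) B

theorem conn_pos_vert (k : Fin n) (x : Fin n × Fin p) (B : Idx p n) :
    D.conn (.inr (.inl k)) (.inr (.inr x)) B = 0 :=
  D.conn_eq_zero (by simp [kind]) B

theorem conn_vert_pos (x : Fin n × Fin p) (i : Fin n) (B : Idx p n) :
    D.conn (.inr (.inr x)) (.inr (.inl i)) B = 0 :=
  D.conn_eq_zero (by simp [kind]) B

theorem conn_inl_inl_inr (γ α : Fin p) (x : Fin n ⊕ (Fin n × Fin p)) :
    D.conn (.inl γ) (.inl α) (.inr x) = 0 := by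
  rcases x with k | ⟨k, γ⟩ <;> rfl

theorem conn_time (γ α β : Fin p) :
    D.conn (.inl γ) (.inl α) (.inl β) = fun z => christoffel D.h γ α β z.1 := rfl

theorem conn_pos_pos (k i j : Fin n) :
    D.conn (.inr (.inl k)) (.inr (.inl i)) (.inr (.inl j)) = D.cartanL k i j := rfl

theorem conn_pos_vertical (k i j : Fin n) (β : Fin p) :
    D.conn (.inr (.inl k)) (.inr (.inl i)) (.inr (.inr (j, β))) = D.cartanC k i j β := rfl

theorem conn_vert (k i j : Fin n) (γ α β : Fin p) :
    D.conn (.inr (.inr (k, γ))) (.inr (.inr (i, α))) (.inr (.inr (j, β))) =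
      if α = γ then D.cartanC k i j β else 0 := by
  funext z
  simp only [conn]
  split_ifs <;> rfl

theorem der_zero (A : Idx p n) (z : Coord p n) : D.der A 0 z = 0 := by
  simp [der]

end Conn

/-- A product of two coefficients linking indices of different kinds must change kind at one of its
factors, and that factor vanishes. -/
theorem curvComp_eq_zero {F A : Idx p n} (h : kind F ≠ kind A) (B C : Idx p n)
    (z : Coord p n) : D.curvComp F A B C z = 0 := by
  have hK (K B C : Idx p n) : D.conn F K C z * D.conn K A B z = 0 := by
    by_cases hF : kind F = kind K
    · rw [D.conn_eq_zero (hF ▸ h : kind K ≠ kind A), Pi.zero_apply, mul_zero]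
    · rw [D.conn_eq_zero hF, Pi.zero_apply, zero_mul]
  simp [curvComp_eq, D.conn_eq_zero h, hK, der_zero]

theorem lieBracket_vert (A B : Fin n × Fin p) (z : Coord p n) :
    VectorField.lieBracket ℝ (D.frame (.inr (.inr A))) (D.frame (.inr (.inr B))) z = 0 := by
  have h (C : Fin n × Fin p) : D.frame (.inr (.inr C)) = fun _ => ddy C.1 C.2 := rfl
  simp [VectorField.lieBracket, h]

namespace Regular

variable (hD : D.Regular U V) {z : Coord p n} (hz : z.1 ∈ U ∧ z.2.1 ∈ V)
include hD hz

theorem fderiv_frame_time (α : Fin p) (v : Coord p n) :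
    fderiv ℝ (D.frame (.inl α)) z v = (0, 0, fun j β => -fderiv ℝ (D.nlM j β α) z v) := by
  have h : HasFDerivAt (fun w => ((basisVec α : E p), (0 : E n), fun j β => -D.nlM j β α w))
      ((0 : Coord p n →L[ℝ] E p).prod ((0 : Coord p n →L[ℝ] E n).prod
        (ContinuousLinearMap.pi fun j => ContinuousLinearMap.pi fun β =>
          -fderiv ℝ (D.nlM j β α) z))) z :=
    (hasFDerivAt_const _ _).prodMk ((hasFDerivAt_const _ _).prodMk
      (hasFDerivAt_pi.2 fun j => hasFDerivAt_pi.2 fun β =>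
        ((hD.contDiffAt_nlM hz j β α).differentiableAt (by simp)).hasFDerivAt.neg))
  rw [funext (D.frame_time α), h.fderiv]
  rfl

theorem fderiv_frame_pos (i : Fin n) (v : Coord p n) :
    fderiv ℝ (D.frame (.inr (.inl i))) z v =
      (0, 0, fun j β => -fderiv ℝ (D.nlN j β i) z v) := by
  have h : HasFDerivAt (fun w => ((0 : E p), (basisVec i : E n), fun j β => -D.nlN j β i w))
      ((0 : Coord p n →L[ℝ] E p).prod ((0 : Coord p n →L[ℝ] E n).prod
        (ContinuousLinearMap.pi fun j => ContinuousLinearMap.pi fun β =>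
          -fderiv ℝ (D.nlN j β i) z))) z :=
    (hasFDerivAt_const _ _).prodMk ((hasFDerivAt_const _ _).prodMk
      (hasFDerivAt_pi.2 fun j => hasFDerivAt_pi.2 fun β =>
        ((hD.contDiffAt_nlN hz j β i).differentiableAt (by simp)).hasFDerivAt.neg))
  rw [funext (D.frame_pos i), h.fderiv]
  rfl

theorem coframe_time_lieBracket_time (γ α β : Fin p) :
    D.coframe (.inl γ) z
      (VectorField.lieBracket ℝ (D.frame (.inl α)) (D.frame (.inl β)) z) = 0 := by
  simp [VectorField.lieBracket, hD.fderiv_frame_time hz, coframe]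

theorem der_pos_nlN (k m j : Fin n) (β : Fin p) :
    D.der (.inr (.inl k)) (D.nlN m β j) z =
      ∑ s, (pd k (christoffel D.φ m s j) z.2.1 -
        ∑ l, christoffel D.φ m l j z.2.1 * christoffel D.φ l s k z.2.1) * z.2.2 s β := by
  have h1 (s : Fin n) := differentiableAt_comp_pos (hD.differentiableAt_christoffel_φ hz m j s)
  have h2 (s : Fin n) : DifferentiableAt ℝ (fun w : Coord p n => w.2.2 s β) z := by fun_prop
  have h3 : D.nlN m β j = fun w => ∑ s, christoffel D.φ m j s w.2.1 * w.2.2 s β := rfl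
  rw [h3, der_sum fun s _ => (h1 s).fun_mul (h2 s)]
  simp only [der_mul (h1 _) (h2 _), der_dir,
    der_pos_comp_pos (hD.differentiableAt_christoffel_φ hz _ _ _), frame_pos, nlN,
    sub_mul, Finset.sum_sub_distrib, Finset.sum_mul, mul_neg, Finset.mul_sum, ← sub_eq_add_neg]
  rw [Finset.sum_comm (f := fun s l => christoffel D.φ m j s z.2.1 * _)]
  congr 1
  · exact Finset.sum_congr rfl fun s _ => by rw [hD.metric_φ.christoffel_symm m j s]
  · refine Finset.sum_congr rfl fun s _ => Finset.sum_congr rfl fun l _ => ?_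
    rw [hD.metric_φ.christoffel_symm m j l, hD.metric_φ.christoffel_symm l k s, mul_assoc]

/-- The nonlinear connection N is linear in the fibre coordinates with coefficients γ, so the
obstruction to integrability of the spatial distribution is the curvature of φ applied to the fibre
coordinates. -/
theorem lieBracket_pos (k j : Fin n) :
    VectorField.lieBracket ℝ (D.frame (.inr (.inl k))) (D.frame (.inr (.inl j))) z =
      (0, 0, fun m β => -∑ s, riemann D.φ m s j k z.2.1 * z.2.2 s β) := by
  simp only [VectorField.lieBracket, hD.fderiv_frame_pos hz]
  refine Prod.ext (by simp) (Prod.ext (by simp) ?_)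
  funext m β
  have h1 := hD.der_pos_nlN hz k m j β
  have h2 := hD.der_pos_nlN hz j m k β
  simp only [der] at h1 h2
  simp only [Prod.snd_sub, Pi.sub_apply, h1, h2, ← Finset.sum_neg_distrib,
    ← Finset.sum_sub_distrib]
  refine Finset.sum_congr rfl fun s _ => ?_
  simp only [riemann, Finset.sum_sub_distrib, mul_comm (christoffel D.φ m _ _ _)]
  ring

/-- Only the temporal component of a bracket could contribute, since the temporal coefficients
vanish in spatial and vertical directions, and it is zero because the brackets of temporal frame
fields are vertical. -/
theorem ric_time (α β : Fin p) : D.ric (.inl α) (.inl β) z = ricci D.h α β z.1 := by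
  have hd (γ α β : Fin p) := hD.differentiableAt_christoffel_h hz γ α β
  simp only [ric, ricci, Fintype.sum_sum_type, curvComp_eq, conn_inr_inl,
    conn_inl_inl_inr, der_zero, conn_time, der_time_comp_time (hd _ _ _), Pi.zero_apply, zero_mul,
    mul_zero, sub_zero, add_zero, Finset.sum_const_zero, hD.coframe_time_lieBracket_time hz,
    riemann, mul_comm]

theorem curvComp_pos (l i j k : Fin n) :
    D.curvComp (.inr (.inl l)) (.inr (.inl i)) (.inr (.inl j)) (.inr (.inl k)) z =
      riemann D.φ l i j k z.2.1 + conf (D.φ z.2.1) (fun r => D.sigCov r k z) l i j -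
      conf (D.φ z.2.1) (fun r => D.sigCov r j z) l i k +
      ∑ m, (conf (D.φ z.2.1) (fun r => D.sigH r z) l m k *
          conf (D.φ z.2.1) (fun r => D.sigH r z) m i j -
        conf (D.φ z.2.1) (fun r => D.sigH r z) l m j *
          conf (D.φ z.2.1) (fun r => D.sigH r z) m i k) +
      ∑ β, ∑ m, conf (D.φ z.2.1) (fun r => D.sigV r β z) l i m *
        ∑ s, riemann D.φ m s j k z.2.1 * z.2.2 s β := by
  have hderL (k i j : Fin n) : D.der (.inr (.inl k)) (D.cartanL l i j) z =
      pd k (christoffel D.φ l i j) z.2.1 +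
        D.der (.inr (.inl k)) (fun w => conf (D.φ w.2.1) (fun m => D.sigH m w) l i j) z := by
    -- The formula for L holds only over U × V, so it is differentiated as an equality near z.
    rw [der_congr ((hD.eventually hz).mono fun w hw => hD.cartanL_eq hw l i j),
      der_add (differentiableAt_comp_pos (hD.differentiableAt_christoffel_φ hz l i j))
        (hD.differentiableAt_conf hz (hD.differentiableAt_sigH hz) l i j),
      der_pos_comp_pos (hD.differentiableAt_christoffel_φ hz l i j)]
  have hcof (m : Fin n) (β : Fin p) : D.coframe (.inr (.inr (m, β))) z
      (0, 0, fun m β => -∑ s, riemann D.φ m s j k z.2.1 * z.2.2 s β) =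
        -∑ s, riemann D.φ m s j k z.2.1 * z.2.2 s β := by
    simp [coframe]
  have hcof1 (γ : Fin p) (y : Fin n → Fin p → ℝ) : D.coframe (.inl γ) z (0, 0, y) = 0 := by
    simp [coframe]
  have hcof2 (m : Fin n) (y : Fin n → Fin p → ℝ) :
      D.coframe (.inr (.inl m)) z (0, 0, y) = 0 := by
    simp [coframe]
  simp only [curvComp_eq, Fintype.sum_sum_type, Fintype.sum_prod_type, conn_inr_inl,
    conn_pos_vert, Pi.zero_apply, zero_mul, sub_self, Finset.sum_const_zero, zero_add, add_zero,
    hD.lieBracket_pos hz, hcof, hcof1, hcof2, mul_zero, conn_pos_pos, conn_pos_vertical, hderL,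
    hD.der_pos_conf hz _ (hD.differentiableAt_sigH hz), hD.cartanL_eq hz, hD.cartanC_eq hz,
    mul_neg, Finset.sum_neg_distrib, sub_neg_eq_add, hD.metric_φ.christoffel_symm _ k j]
  rw [Finset.sum_comm (f := fun (m : Fin n) (β : Fin p) => _)]
  simp only [sigCov, riemann, add_mul, mul_add, Finset.sum_add_distrib, Finset.sum_sub_distrib]
  have hc (F G : Fin n → ℝ) : ∑ m, F m * G m = ∑ m, G m * F m := by simp only [mul_comm]
  -- Factors are put in a common order so that `ring` sees equal sums as equal atoms; the mixed
  -- γ-`conf` sums then cancel, symmetry of γ having removed the difference coming from the index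
  -- pair j, k.
  rw [hc (fun m => christoffel D.φ m i j z.2.1) fun m => christoffel D.φ l m k z.2.1,
    hc (fun m => christoffel D.φ m i k z.2.1) fun m => christoffel D.φ l m j z.2.1,
    hc (fun m => christoffel D.φ m i j z.2.1),
    hc (fun m => christoffel D.φ m i k z.2.1)]
  ring

end Regular

end LocalData

/-! ### Spatial and vertical Ricci tensors -/

namespace LocalData

variable {p n : ℕ} {D : LocalData p n} {U : Set (E p)} {V : Set (E n)}

namespace Regular

variable (hD : D.Regular U V) {z : Coord p n} (hz : z.1 ∈ U ∧ z.2.1 ∈ V)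
include hD hz

theorem ric_pos (i j : Fin n) :
    D.ric (.inr (.inl i)) (.inr (.inl j)) z =
      ricci D.φ i j z.2.1 + ∑ k, conf (D.φ z.2.1) (fun r => D.sigCov r k z) k i j -
      n * D.sigCov i j z +
      (n - 2) * (D.sigH i z * D.sigH j z - D.φ z.2.1 i j *
        ∑ r, ∑ m, (D.φ z.2.1)⁻¹ r m * D.sigH r z * D.sigH m z) +
      ∑ β, ∑ k, ∑ m, conf (D.φ z.2.1) (fun r => D.sigV r β z) k i m *
        ∑ s, riemann D.φ m s j k z.2.1 * z.2.2 s β := by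
  have hs := hD.φ_symm z.2.1
  have hsi := hD.metric_φ.inv_symm z.2.1
  have hφ := hD.metric_φ.mul_inv hz.2
  have h1 (γ : Fin p) : D.curvComp (.inl γ) (.inr (.inl i)) (.inr (.inl j)) (.inl γ) z = 0 :=
    curvComp_eq_zero (by simp [kind]) _ _ _
  have h2 (x : Fin n × Fin p) :
      D.curvComp (.inr (.inr x)) (.inr (.inl i)) (.inr (.inl j)) (.inr (.inr x)) z = 0 :=
    curvComp_eq_zero (by simp [kind]) _ _ _
  have h3 : ∑ k, ∑ m, conf (D.φ z.2.1) (fun r => D.sigH r z) k m k *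
      conf (D.φ z.2.1) (fun r => D.sigH r z) m i j =
      n * (2 * (D.sigH i z * D.sigH j z) - D.φ z.2.1 i j *
        ∑ r, ∑ m, (D.φ z.2.1)⁻¹ r m * D.sigH r z * D.sigH m z) := by
    rw [Finset.sum_comm]
    simp only [← Finset.sum_mul, sum_conf_contract hφ]
    simp only [mul_assoc, ← Finset.mul_sum, sum_mul_conf]
    ring
  simp only [ric, Fintype.sum_sum_type, h1, h2, hD.curvComp_pos hz, Finset.sum_const_zero,
    Finset.sum_add_distrib, Finset.sum_sub_distrib, sum_conf_contract hφ, h3,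
    sum_conf_mul_conf hs hsi hφ, ricci]
  rw [Finset.sum_comm (f := fun (k : Fin n) (β : Fin p) => _)]
  ring

/-- The curvature is diagonal in the upper temporal index, so the trace over (k, γ) keeps only γ =
α. Second derivatives are left in the order in which they arise; their symmetry is never used. -/
theorem ric_vert (i j : Fin n) (α β : Fin p) :
    D.ric (.inr (.inr (i, α))) (.inr (.inr (j, β))) z =
      ∑ k, conf (D.φ z.2.1) (fun r => D.der (.inr (.inr (k, α))) (D.sigV r β) z) k i j -
      n * D.der (.inr (.inr (j, β))) (D.sigV i α) z +
      (n - 2) * (D.sigV j α z * D.sigV i β z - D.φ z.2.1 i j *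
        ∑ r, ∑ m, (D.φ z.2.1)⁻¹ r m * D.sigV r α z * D.sigV m β z) := by
  have hs := hD.φ_symm z.2.1
  have hsi := hD.metric_φ.inv_symm z.2.1
  have hφ := hD.metric_φ.mul_inv hz.2
  have hder (A : Fin n × Fin p) (k i j : Fin n) (γ : Fin p) :
      D.der (.inr (.inr A)) (D.cartanC k i j γ) z =
        conf (D.φ z.2.1) (fun r => D.der (.inr (.inr A)) (D.sigV r γ) z) k i j := by
    rw [der_congr ((hD.eventually hz).mono fun w hw => hD.cartanC_eq hw k i j γ)]
    exact hD.der_vert_conf hz _ _ (fun m => hD.differentiableAt_sigV hz m γ) k i j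
  have hcurv (k : Fin n) (γ : Fin p) :
      D.curvComp (.inr (.inr (k, γ))) (.inr (.inr (i, α))) (.inr (.inr (j, β)))
        (.inr (.inr (k, γ))) z = if α = γ then
          D.der (.inr (.inr (k, α))) (D.cartanC k i j β) z -
          D.der (.inr (.inr (j, β))) (D.cartanC k i k α) z +
          ∑ m, (D.cartanC k m k α z * D.cartanC m i j β z -
            D.cartanC k m j β z * D.cartanC m i k α z) else 0 := by
    have hc0 (K : Idx p n) : D.coframe K z 0 = 0 := map_zero (D.coframeLin K z)
    have hap (c : Prop) [Decidable c] (f : Coord p n → ℝ) :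
        (if c then f else 0) z = if c then f z else 0 := by split_ifs <;> rfl
    simp only [curvComp_eq, Fintype.sum_sum_type, Fintype.sum_prod_type, lieBracket_vert,
      conn_vert, hc0, mul_zero, Finset.sum_const_zero, sub_zero, conn_inr_inl, Pi.zero_apply,
      zero_mul, zero_add, conn_vert_pos, hap]
    -- For α = γ, the deltas in the quadratic terms select the single intermediate index μ = α.
    -- Otherwise no μ can equal both α and γ.
    split_ifs with h
    · subst h
      congr 1
      refine Finset.sum_congr rfl fun m _ => ?_
      rw [Finset.sum_eq_single α (fun μ _ hμ => by simp [hμ]) (by simp)]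
      simp only [if_true]
    · rw [der_zero, der_zero, sub_zero, zero_add]
      refine Finset.sum_eq_zero fun m _ => Finset.sum_eq_zero fun μ _ => ?_
      split_ifs with h1 h2 <;> first | exact absurd (h2.trans h1) h | simp
  have h1 (γ : Fin p) : D.curvComp (.inl γ) (.inr (.inr (i, α))) (.inr (.inr (j, β))) (.inl γ) z
      = 0 := curvComp_eq_zero (by simp [kind]) _ _ _
  have h2 (k : Fin n) : D.curvComp (.inr (.inl k)) (.inr (.inr (i, α))) (.inr (.inr (j, β)))
      (.inr (.inl k)) z = 0 := curvComp_eq_zero (by simp [kind]) _ _ _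
  have h3 : ∑ k, ∑ m, conf (D.φ z.2.1) (fun r => D.sigV r α z) k m k *
      conf (D.φ z.2.1) (fun r => D.sigV r β z) m i j =
      n * (D.sigV i α z * D.sigV j β z + D.sigV j α z * D.sigV i β z - D.φ z.2.1 i j *
        ∑ r, ∑ m, (D.φ z.2.1)⁻¹ r m * D.sigV r α z * D.sigV m β z) := by
    rw [Finset.sum_comm]
    simp only [← Finset.sum_mul, sum_conf_contract hφ]
    simp only [mul_assoc, ← Finset.mul_sum, sum_mul_conf]
  have h4 : ∑ r, ∑ m, (D.φ z.2.1)⁻¹ r m * D.sigV r β z * D.sigV m α z =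
      ∑ r, ∑ m, (D.φ z.2.1)⁻¹ r m * D.sigV r α z * D.sigV m β z := by
    rw [Finset.sum_comm]
    exact Finset.sum_congr rfl fun r _ => Finset.sum_congr rfl fun m _ => by rw [hsi]; ring
  simp only [ric, Fintype.sum_sum_type, Fintype.sum_prod_type, h1, h2, hcurv,
    Finset.sum_const_zero, zero_add, Finset.sum_ite_eq, Finset.mem_univ, if_true, hder,
    hD.cartanC_eq hz, Finset.sum_add_distrib, Finset.sum_sub_distrib, sum_conf_contract hφ, h3,
    sum_conf_mul_conf hs hsi hφ, h4]
  ring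

end Regular

end LocalData

theorem sum_mul_comb {ι κ : Type*} [Fintype ι] [Fintype κ] (w F G H : ι → κ → ℝ) (x y t : ℝ) :
    ∑ i, ∑ j, w i j * (x * F i j + y * G i j + t * H i j) =
      x * ∑ i, ∑ j, w i j * F i j + y * ∑ i, ∑ j, w i j * G i j +
        t * ∑ i, ∑ j, w i j * H i j := by
  simp only [Finset.mul_sum, ← Finset.sum_add_distrib]
  exact Finset.sum_congr rfl fun i _ => Finset.sum_congr rfl fun j _ => by ring

/-! ### Traces and the scalar curvature -/

namespace LocalData

variable {p n : ℕ} {D : LocalData p n} {U : Set (E p)} {V : Set (E n)}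

namespace Regular

variable (hD : D.Regular U V) {z : Coord p n} (hz : z.1 ∈ U ∧ z.2.1 ∈ V)
include hD hz

theorem partH_eq : D.partH z = scalarCurv D.h z.1 := by
  simp only [partH, scalarCurv, hD.ric_time hz]

/-- The trace of the Ricci tensor of a conformally changed metric, where `c` stands for the
covariant derivatives of the vectors `a`, `b`. -/
theorem trace_conf_ricci (a b : Fin n → ℝ) (c c' : Fin n → Fin n → ℝ) :
    ∑ i, ∑ j, (D.φ z.2.1)⁻¹ i j *
      (∑ k, conf (D.φ z.2.1) (fun r => c r k) k i j - n * c' i j +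
        (n - 2) * (a j * b i - D.φ z.2.1 i j * ∑ r, ∑ m, (D.φ z.2.1)⁻¹ r m * a r * b m)) =
      (2 - n) * ∑ r, ∑ s, (D.φ z.2.1)⁻¹ r s * c r s - n * ∑ r, ∑ s, (D.φ z.2.1)⁻¹ r s * c' r s +
        (n - 2) * (1 - n) * ∑ r, ∑ m, (D.φ z.2.1)⁻¹ r m * a r * b m := by
  have hs := hD.φ_symm z.2.1
  have hsi := hD.metric_φ.inv_symm z.2.1
  have hφ := hD.metric_φ.mul_inv hz.2
  set Q := ∑ r, ∑ m, (D.φ z.2.1)⁻¹ r m * a r * b m with hQ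
  have h1 : ∑ i, ∑ j, (D.φ z.2.1)⁻¹ i j * ∑ k, conf (D.φ z.2.1) (fun r => c r k) k i j =
      (2 - n) * ∑ r, ∑ s, (D.φ z.2.1)⁻¹ r s * c r s := by
    simp only [Finset.mul_sum]
    rw [Finset.sum_congr rfl fun i _ => Finset.sum_comm, Finset.sum_comm]
    simp only [trace_conf hs hsi hφ, ← Finset.mul_sum]
    rw [Finset.sum_comm]
    simp only [hsi]
  have h2 : ∑ i, ∑ j, (D.φ z.2.1)⁻¹ i j * (a j * b i) = Q := by
    rw [hQ, Finset.sum_comm]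
    exact Finset.sum_congr rfl fun r _ => Finset.sum_congr rfl fun m _ => by rw [hsi]; ring
  have h3 := trace_inv_mul hs hφ
  -- Only two terms are needed here; the third slot is filler with coefficient 0.
  have h4 := sum_mul_comb (fun i j => (D.φ z.2.1)⁻¹ i j) (fun i j => a j * b i)
    (fun i j => D.φ z.2.1 i j) (fun i j => D.φ z.2.1 i j) 1 (-Q) 0
  have h5 := sum_mul_comb (fun i j => (D.φ z.2.1)⁻¹ i j) 
    (fun i j => ∑ k, conf (D.φ z.2.1) (fun r => c r k) k i j) c'
    (fun i j => 1 * (a j * b i) + -Q * D.φ z.2.1 i j + 0 * D.φ z.2.1 i j) 1 (-n) (n - 2)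
  rw [h4, h1, h2, h3] at h5
  refine Eq.trans (Finset.sum_congr rfl fun i _ => Finset.sum_congr rfl fun j _ => ?_)
    (h5.trans ?_) <;> ring

theorem brH_eq : D.brH z = ∑ r, ∑ s, (D.φ z.2.1)⁻¹ r s * D.sigCov r s z +
    (n - 2) / 2 * ∑ r, ∑ m, (D.φ z.2.1)⁻¹ r m * D.sigH r z * D.sigH m z := by
  have h3 := trace_inv_mul (hD.φ_symm z.2.1) (hD.metric_φ.mul_inv hz.2)
  simp only [brH, sigHH]
  set Q := ∑ r, ∑ m, (D.φ z.2.1)⁻¹ r m * D.sigH r z * D.sigH m z with hQ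
  have h4 := sum_mul_comb (fun i j => (D.φ z.2.1)⁻¹ i j) (fun r s => D.sigCov r s z)
    (fun r s => D.sigH r z * D.sigH s z) (fun i j => D.φ z.2.1 i j) 1 (-1) (1 / 2 * Q)
  simp only [← mul_assoc _ (D.sigH _ z), ← hQ, h3] at h4
  refine Eq.trans (Finset.sum_congr rfl fun i _ => Finset.sum_congr rfl fun j _ => ?_)
    (h4.trans ?_) <;> ring

theorem brV_eq : D.brV z = ∑ α, ∑ β, D.h z.1 α β *
    (∑ r, ∑ s, (D.φ z.2.1)⁻¹ r s * D.der (.inr (.inr (s, β))) (D.sigV r α) z +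
    (n - 2) / 2 * ∑ r, ∑ m, (D.φ z.2.1)⁻¹ r m * D.sigV r α z * D.sigV m β z) := by
  have h3 := trace_inv_mul (hD.φ_symm z.2.1) (hD.metric_φ.mul_inv hz.2)
  unfold brV
  refine Finset.sum_congr rfl fun α _ => Finset.sum_congr rfl fun β _ => congrArg _ ?_
  simp only [sigVV]
  set Q := ∑ r, ∑ m, (D.φ z.2.1)⁻¹ r m * D.sigV r α z * D.sigV m β z with hQ
  have h4 := sum_mul_comb (fun i j => (D.φ z.2.1)⁻¹ i j)
    (fun r s => D.der (.inr (.inr (s, β))) (D.sigV r α) z)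
    (fun r s => D.sigV r α z * D.sigV s β z) (fun i j => D.φ z.2.1 i j) 1 (-1) (1 / 2 * Q)
  simp only [← mul_assoc _ (D.sigV _ _ z), ← hQ, h3] at h4
  refine Eq.trans (Finset.sum_congr rfl fun i _ => Finset.sum_congr rfl fun j _ => ?_)
    (h4.trans ?_) <;> ring

/-- For each β the array formed by the curvature of φ and the fibre coordinates is antisymmetric in
j, k, so the abstract trace identity applies; its remaining contraction is the Ricci tensor of φ. -/
theorem trace_curvature_sigV :
    ∑ i, ∑ j, (D.φ z.2.1)⁻¹ i j *
      ∑ β, ∑ k, ∑ m, conf (D.φ z.2.1) (fun r => D.sigV r β z) k i m *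
        ∑ s, riemann D.φ m s j k z.2.1 * z.2.2 s β =
      2 * ∑ m, ∑ s, ∑ μ, ricci D.φ m s z.2.1 * D.sigUp s μ z * z.2.2 m μ := by
  have hsi := hD.metric_φ.inv_symm z.2.1
  have hφ := hD.metric_φ.inv_mul hz.2
  have h1 (β : Fin p) := trace_conf_mul_antisymm hsi hφ (fun r => D.sigV r β z)
    (R := fun m j k => ∑ s, riemann D.φ m s j k z.2.1 * z.2.2 s β) fun m j k => by
      simp only [← Finset.sum_neg_distrib, riemann_antisymm D.φ m _ j k, neg_mul]
  have h2 : ∑ i, ∑ j, (D.φ z.2.1)⁻¹ i j *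
      ∑ β, ∑ k, ∑ m, conf (D.φ z.2.1) (fun r => D.sigV r β z) k i m *
        ∑ s, riemann D.φ m s j k z.2.1 * z.2.2 s β =
      ∑ β, ∑ i, ∑ j, (D.φ z.2.1)⁻¹ i j *
      ∑ k, ∑ m, conf (D.φ z.2.1) (fun r => D.sigV r β z) k i m *
        ∑ s, riemann D.φ m s j k z.2.1 * z.2.2 s β := by
    simp only [Finset.mul_sum (s := (Finset.univ : Finset (Fin p)))]
    rw [Finset.sum_congr rfl fun i _ => Finset.sum_comm, Finset.sum_comm]
  rw [h2, Finset.sum_congr rfl fun β _ => h1 β, ← Finset.mul_sum]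
  congr 1
  have h3 (β : Fin p) (j : Fin n) : ∑ k, ∑ s, riemann D.φ k s j k z.2.1 * z.2.2 s β =
      ∑ s, ricci D.φ s j z.2.1 * z.2.2 s β := by
    rw [Finset.sum_comm]
    simp only [ricci, Finset.sum_mul]
  have h4 (j : Fin n) (β : Fin p) :
      ∑ m, (D.φ z.2.1)⁻¹ j m * D.sigV m β z = D.sigUp j β z := rfl
  simp only [h3, h4, Finset.mul_sum]
  rw [Finset.sum_comm, Finset.sum_congr rfl fun j _ => Finset.sum_comm, Finset.sum_comm]
  exact Finset.sum_congr rfl fun m _ => Finset.sum_congr rfl fun s _ =>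
    Finset.sum_congr rfl fun μ _ => by ring

theorem partR_eq : D.partR z = Real.exp (-2 * D.σ z) *
    (scalarCurv D.φ z.2.1 + 2 * (1 - (n : ℝ)) * D.brH z +
      2 * ∑ m, ∑ s, ∑ μ, ricci D.φ m s z.2.1 * D.sigUp s μ z * z.2.2 m μ) := by
  have h1 := hD.trace_conf_ricci hz (fun r => D.sigH r z) (fun r => D.sigH r z)
    (fun r s => D.sigCov r s z) (fun r s => D.sigCov r s z)
  have h2 : ∑ i, ∑ j, (D.φ z.2.1)⁻¹ i j * D.ric (.inr (.inl i)) (.inr (.inl j)) z =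
      scalarCurv D.φ z.2.1 + 2 * (1 - (n : ℝ)) * D.brH z +
      2 * ∑ m, ∑ s, ∑ μ, ricci D.φ m s z.2.1 * D.sigUp s μ z * z.2.2 m μ := by
    rw [← hD.trace_curvature_sigV hz, hD.brH_eq hz]
    -- With c = c' the coefficients 2 − n and −n add up to 2(1 − n), and the quadratic coefficient
    -- (n − 2)(1 − n) is 2(1 − n) times the (n − 2)/2 found in `brH_eq`.
    have h3 : 2 * (1 - (n : ℝ)) * (∑ r, ∑ s, (D.φ z.2.1)⁻¹ r s * D.sigCov r s z +
        (n - 2) / 2 * ∑ r, ∑ m, (D.φ z.2.1)⁻¹ r m * D.sigH r z * D.sigH m z) = _ :=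
      Eq.trans (by ring) h1.symm
    rw [h3, scalarCurv]
    simp only [← Finset.sum_add_distrib]
    refine Finset.sum_congr rfl fun i _ => Finset.sum_congr rfl fun j _ => ?_
    rw [hD.ric_pos hz]
    ring
  rw [← h2]
  simp only [partR, Finset.mul_sum, mul_assoc]

theorem partS_eq :
    D.partS z = 2 * (1 - (n : ℝ)) * Real.exp (-2 * D.σ z) * D.brV z := by
  have h1 (α β : Fin p) := hD.trace_conf_ricci hz (fun r => D.sigV r α z) (fun r => D.sigV r β z)
    (fun r s => D.der (.inr (.inr (s, α))) (D.sigV r β) z)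
    (fun r s => D.der (.inr (.inr (s, β))) (D.sigV r α) z)
  simp only [← hD.ric_vert hz] at h1
  set B : Fin p → Fin p → ℝ := fun α β =>
    ∑ r, ∑ s, (D.φ z.2.1)⁻¹ r s * D.der (.inr (.inr (s, β))) (D.sigV r α) z with hB
  have h2 : D.partS z = Real.exp (-2 * D.σ z) * ∑ α, ∑ β, D.h z.1 α β *
      ∑ i, ∑ j, (D.φ z.2.1)⁻¹ i j * D.ric (.inr (.inr (i, α))) (.inr (.inr (j, β))) z := by
    have h3 (F : Fin n → Fin n → Fin p → Fin p → ℝ) :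
        ∑ i, ∑ j, ∑ α, ∑ β, F i j α β = ∑ α, ∑ β, ∑ i, ∑ j, F i j α β := by
      rw [Finset.sum_congr rfl fun i _ => Finset.sum_comm, Finset.sum_comm]
      refine Finset.sum_congr rfl fun α _ => ?_
      rw [Finset.sum_congr rfl fun i _ => Finset.sum_comm, Finset.sum_comm]
    rw [partS, h3]
    simp only [Finset.mul_sum]
    refine Finset.sum_congr rfl fun α _ => Finset.sum_congr rfl fun β _ =>
      Finset.sum_congr rfl fun i _ => Finset.sum_congr rfl fun j _ => by ring
  -- The two second-derivative traces differ by exchanging α and β, which contraction with the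
  -- symmetric h does not see; they merge into the coefficient 2(1 − n).
  have h4 : ∑ α, ∑ β, D.h z.1 α β * B β α = ∑ α, ∑ β, D.h z.1 α β * B α β := by
    rw [Finset.sum_comm]
    exact Finset.sum_congr rfl fun α _ => Finset.sum_congr rfl fun β _ => by rw [hD.h_symm]
  set Q : Fin p → Fin p → ℝ := fun α β =>
    ∑ r, ∑ m, (D.φ z.2.1)⁻¹ r m * D.sigV r α z * D.sigV m β z with hQ
  have h5 := sum_mul_comb (D.h z.1) (fun α β => B β α) B Q (2 - n) (-n) ((n - 2) * (1 - n))
  have h6 := sum_mul_comb (D.h z.1) B Q Q 1 ((n - 2) / 2) 0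
  have h7 : D.brV z = ∑ α, ∑ β, D.h z.1 α β * (1 * B α β + (n - 2) / 2 * Q α β + 0 * Q α β) := by
    rw [hD.brV_eq hz]
    simp only [hB, hQ, one_mul, zero_mul, add_zero]
  rw [h2, h7, h6, Finset.sum_congr rfl fun α _ => Finset.sum_congr rfl fun β _ =>
    congrArg (D.h z.1 α β * ·) ((h1 α β).trans (by ring :
      _ = (2 - (n : ℝ)) * B β α + -n * B α β + (n - 2) * (1 - n) * Q α β)), h5, h4]
  ring

/-- The inverse of the gravitational potential. -/
theorem G_inv : (D.G z)⁻¹ = Matrix.of fun A B =>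
    match A, B with
    | .inl α, .inl β => (D.h z.1)⁻¹ α β
    | .inr (.inl i), .inr (.inl j) => (D.g z)⁻¹ i j
    | .inr (.inr (i, α)), .inr (.inr (j, β)) => D.h z.1 α β * (D.g z)⁻¹ i j
    | _, _ => 0 := by
  have hg : D.g z * (D.g z)⁻¹ = 1 := by
    rw [D.g_inv, g, Matrix.smul_mul, Matrix.mul_smul, hD.metric_φ.mul_inv hz.2, smul_smul,
      ← Real.exp_add]
    simp
  have hh := hD.metric_h.mul_inv hz.1
  have hh' := hD.metric_h.inv_mul hz.1
  have hg1 (i j : Fin n) := congrFun (congrFun hg i) j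
  have hh1 (i j : Fin p) := congrFun (congrFun hh i) j
  have hh2 (i j : Fin p) := congrFun (congrFun hh' i) j
  simp only [Matrix.mul_apply] at hg1 hh1 hh2
  refine Matrix.inv_eq_right_inv ?_
  ext A B
  rcases A with α | i | ⟨i, α⟩ <;> rcases B with β | j | ⟨j, β⟩ <;>
    simp [Matrix.mul_apply, Fintype.sum_sum_type, Fintype.sum_prod_type, G, hg1, hh1,
      Matrix.one_apply]
  -- The remaining case is the vertical block: it is the tensor product of h⁻¹ and g, so the product
  -- of matrices factors into two identities.
  have h1 : ∑ k, ∑ γ, (D.h z.1)⁻¹ α γ * D.g z i k * (D.h z.1 γ β * (D.g z)⁻¹ k j) =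
      (∑ k, D.g z i k * (D.g z)⁻¹ k j) * ∑ γ, (D.h z.1)⁻¹ α γ * D.h z.1 γ β := by
    rw [Finset.sum_mul_sum]
    exact Finset.sum_congr rfl fun k _ => Finset.sum_congr rfl fun γ _ => by ring
  rw [h1, hg1, hh2, Matrix.one_apply, Matrix.one_apply]
  by_cases hi : i = j <;> by_cases ha : α = β <;> simp [hi, ha]

theorem Sc_eq : D.Sc z = D.partH z + D.partR z + D.partS z := by
  have he : Real.exp (-(2 * D.σ z)) = Real.exp (-2 * D.σ z) := by rw [neg_mul]
  simp only [Sc, hD.G_inv hz, Fintype.sum_sum_type, Fintype.sum_prod_type, Matrix.of_apply,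
    zero_mul, Finset.sum_const_zero, add_zero, zero_add, D.g_inv, Matrix.smul_apply, smul_eq_mul,
    he, partH, partR, partS, add_assoc]
  congr 2
  refine Finset.sum_congr rfl fun i _ => ?_
  rw [Finset.sum_comm]
  refine Finset.sum_congr rfl fun j _ => ?_
  refine Finset.sum_congr rfl fun α _ => Finset.sum_congr rfl fun β _ => by ring

end Regular

end LocalData

end GRGML

theorem mainTheorem6 {p n : ℕ} {T M : Type*}
    [TopologicalSpace T] [ChartedSpace (GRGML.E p) T] [IsManifold (𝓡 p) ∞ T]
    [TopologicalSpace M] [ChartedSpace (GRGML.E n) M] [IsManifold (𝓡 n) ∞ M]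
    (h : GRGML.SemiRiemannianMetric p T) (φ : GRGML.SemiRiemannianMetric n M)
    (σ : GRGML.OneJet p n T M → ℝ) (hσ : GRGML.JetSmooth σ)
    (e : OpenPartialHomeomorph T (GRGML.E p)) (he : e ∈ IsManifold.maximalAtlas (𝓡 p) ∞ T)
    (f : OpenPartialHomeomorph M (GRGML.E n)) (hf : f ∈ IsManifold.maximalAtlas (𝓡 n) ∞ M)
    (D : GRGML.LocalData p n) (hD : D = GRGML.localData h φ σ e f)
    (q : GRGML.OneJet p n T M) (hqT : q.time ∈ e.source) (hqM : q.pos ∈ f.source)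
    (z : GRGML.Coord p n) (hz : z = q.coords e f) :
    D.Sc z = D.partH z + D.partR z + D.partS z ∧
    D.partH z = GRGML.scalarCurv (h.components e) z.1 ∧
    D.partR z = Real.exp (-2 * σ q) *
      (GRGML.scalarCurv (φ.components f) z.2.1 + 2 * (1 - (n : ℝ)) * D.brH z +
        2 * ∑ m, ∑ s, ∑ μ, GRGML.ricci (φ.components f) m s z.2.1 * D.sigUp s μ z * z.2.2 m μ) ∧
    D.partS z = 2 * (1 - (n : ℝ)) * Real.exp (-2 * σ q) * D.brV z := by
  have hR : D.Regular e.target f.target := hD ▸ GRGML.localData_regular h φ hσ he hf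
  have hmem : z.1 ∈ e.target ∧ z.2.1 ∈ f.target := by
    rw [hz]
    exact ⟨e.map_source hqT, f.map_source hqM⟩
  have hσz : D.σ z = σ q := by
    rw [hD, hz]
    exact congrArg σ (GRGML.OneJet.ofCoords_coords he hf q hqT hqM)
  have hh : D.h = h.components e := by rw [hD]; rfl
  have hφ : D.φ = φ.components f := by rw [hD]; rfl
  rw [← hσz, ← hh, ← hφ]
  exact ⟨hR.Sc_eq hmem, hR.partH_eq hmem, hR.partR_eq hmem, hR.partS_eq hmem⟩
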